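/- A tracial von Neumann algebra is a von Neumann algebra with a fixed faithful normal tracial state $\tau$; write $\|x\|_2=\tau(x^*x)^{1/2}$. An embedding of tracial von Neumann algebras is a unital trace-preserving $*$-homomorphism, and subalgebras are unital von Neumann subalgebras with the restricted trace. For an ultrafilter $\mathcal U$ on a set $I$, the ultrapower $M^{\mathcal U}$ is the algebra of operator-norm bounded families $(x_i)_{i\in I}$ in $M$ modulo those with $\lim_{\mathcal U}\|x_i\|_2=0$, with trace $(x_i)_{\mathcal U}\mapsto\lim_{\mathcal U}\tau(x_i)$. A tracial von Neumann algebra $M$ is existentially closed (e.c.) if, whenever $M$ is contained in a tracial von Neumann algebra $P$ (trace-preservingly), there are an ultrafilter $\mathcal U$ on some set and an embedding of $P$ into $M^{\mathcal U}$ that restricts to the diagonal embedding of $M$. Theorem. Let $M$ be an e.c. II$_1$ factor with trace $\tau$. (1) Let $N\subseteq M$ be a subalgebra and $f:N\to M$ an embedding. Then $f$ is approximately unitarily conjugate to the inclusion map: for every finite set $F\subseteq N$ and every $\epsilon>0$ there is a unitary $v\in M$ such that $\|vf(x)v^*-x\|_2<\epsilon$ for all $x\in F$. (2) In particular, if $M$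 is moreover separable (for $\|\cdot\|_2$), then every embedding $f:M\to M$ is approximately inner: there is a sequence of unitaries $v_n\in M$ with $\lim_{n\to\infty}\|v_nxv_n^*-f(x)\|_2=0$ for all $x\in M$. -/

import Mathlib

open Filter Topology

universe u

noncomputable section

namespace VonNeumannAlgebra

variable {H : Type u} [NormedAddCommGroup H] [InnerProductSpace ℂ H] [CompleteSpace H]

/-- The type of elements of a von Neumann algebra, with its structure of a unital
`*`-algebra over `ℂ` and its operator norm. -/
abbrev Elem (M : VonNeumannAlgebra H) : Type u := M.toStarSubalgebra

/-- A factor: the centre `M ∩ M'` consists of the scalars. -/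
def IsFactor (M : VonNeumannAlgebra H) : Prop :=
  ∀ x : M.Elem, (∀ y : M.Elem, x * y = y * x) → ∃ c : ℂ, x = algebraMap ℂ M.Elem c

/-- A faithful normal tracial state on a von Neumann algebra. A *tracial von Neumann algebra* is
a von Neumann algebra together with such a state. -/
structure Trace (M : VonNeumannAlgebra H) where
  toLinearMap : M.Elem →ₗ[ℂ] ℂ
  map_one : toLinearMap 1 = 1
  pos : ∀ x : M.Elem, (x : H →L[ℂ] H).IsPositive →
    0 ≤ (toLinearMap x).re ∧ (toLinearMap x).im = 0
  mul_comm : ∀ x y : M.Elem, toLinearMap (x * y) = toLinearMap (y * x)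
  faithful : ∀ x : M.Elem, toLinearMap (star x * x) = 0 → x = 0
  /-- Normality, i.e. ultraweak continuity: the functional has the form
  `x ↦ ∑ₙ ⟨ηₙ, x ξₙ⟩` for square-summable sequences of vectors `ξ`, `η`. -/
  normal : ∃ ξ η : ℕ → H, Summable (fun n => ‖ξ n‖ ^ 2) ∧ Summable (fun n => ‖η n‖ ^ 2) ∧
    ∀ x : M.Elem,
      HasSum (fun n => inner ℂ (η n) ((x : H →L[ℂ] H) (ξ n))) (toLinearMap x)

namespace Trace

variable {M : VonNeumannAlgebra H}

instance : CoeFun (Trace M) (fun _ => M.Elem → ℂ) := ⟨fun τ => τ.toLinearMap⟩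

/-- The trace norm `‖x‖₂ = τ(x* x)^(1/2)`. -/
def norm2 (τ : Trace M) (x : M.Elem) : ℝ := √(τ (star x * x)).re

variable (τ : Trace M)

theorem norm2_nonneg (x : M.Elem) : 0 ≤ τ.norm2 x := Real.sqrt_nonneg _

theorem star_mul_self_pos (x : M.Elem) :
    0 ≤ (τ (star x * x)).re ∧ (τ (star x * x)).im = 0 :=
  τ.pos _ (ContinuousLinearMap.isPositive_adjoint_comp_self (x : H →L[ℂ] H))

theorem norm2_sq (x : M.Elem) : τ.norm2 x ^ 2 = (τ (star x * x)).re :=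
  Real.sq_sqrt (τ.star_mul_self_pos x).1

theorem norm2_zero : τ.norm2 0 = 0 := by simp [norm2]

theorem norm2_star (x : M.Elem) : τ.norm2 (star x) = τ.norm2 x := by
  simp only [norm2, star_star, τ.mul_comm x (star x)]

theorem norm2_mul_le (a x : M.Elem) : τ.norm2 (a * x) ≤ ‖a‖ * τ.norm2 x := by
  have hp : (((‖a‖ ^ 2 : ℝ) : ℂ) • (1 : H →L[ℂ] H) -
      star (a : H →L[ℂ] H) * (a : H →L[ℂ] H)).IsPositive := by
    refine (ContinuousLinearMap.isPositive_def').2 ⟨?_, fun v => ?_⟩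
    · refine IsSelfAdjoint.sub ?_ (IsSelfAdjoint.star_mul_self _)
      rw [isSelfAdjoint_iff]
      simp
    · have h1 : ‖(a : H →L[ℂ] H) v‖ ≤ ‖a‖ * ‖v‖ := (a : H →L[ℂ] H).le_opNorm v
      have h2 : ‖(a : H →L[ℂ] H) v‖ ^ 2 ≤ ‖a‖ ^ 2 * ‖v‖ ^ 2 := by
        rw [← mul_pow]; gcongr
      have h3 : inner ℂ ((star (a : H →L[ℂ] H) * (a : H →L[ℂ] H)) v) v
          = ((‖(a : H →L[ℂ] H) v‖ ^ 2 : ℝ) : ℂ) := by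
        rw [mul_apply_eq_comp, ContinuousLinearMap.star_eq_adjoint,
          ContinuousLinearMap.adjoint_inner_left, inner_self_eq_norm_sq_to_K]
        norm_cast
      rw [ContinuousLinearMap.reApplyInnerSelf, sub_apply, inner_sub_left, h3,
        smul_apply, inner_smul_left, one_apply_eq_self,
        inner_self_eq_norm_sq_to_K, map_sub]
      have h4 : (starRingEnd ℂ ((‖a‖ ^ 2 : ℝ) : ℂ)) * ((‖v‖ : ℝ) : ℂ) ^ 2
          = ((‖a‖ ^ 2 * ‖v‖ ^ 2 : ℝ) : ℂ) := by
        rw [Complex.conj_ofReal]; push_cast; ring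
      have h5 : 0 ≤ (((‖a‖ ^ 2 * ‖v‖ ^ 2 : ℝ) : ℂ)).re -
          (((‖(a : H →L[ℂ] H) v‖ ^ 2 : ℝ) : ℂ)).re := by
        rw [Complex.ofReal_re, Complex.ofReal_re]
        exact sub_nonneg.2 h2
      rw [← h4] at h5
      exact h5
  have hq := τ.pos (star x * ((((‖a‖ ^ 2 : ℝ) : ℂ) • (1 : M.Elem) - star a * a) * x))
    (hp.adjoint_conj (x : H →L[ℂ] H))
  have he : star x * ((((‖a‖ ^ 2 : ℝ) : ℂ) • (1 : M.Elem) - star a * a) * x)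
      = ((‖a‖ ^ 2 : ℝ) : ℂ) • (star x * x) - star (a * x) * (a * x) := by
    simp only [sub_mul, mul_sub, star_mul, smul_mul_assoc, one_mul, mul_smul_comm, mul_assoc]
  rw [he, map_sub, map_smul, smul_eq_mul, Complex.sub_re, Complex.re_ofReal_mul,
    ← norm2_sq, ← norm2_sq] at hq
  refine le_of_sq_le_sq ?_ (mul_nonneg (norm_nonneg _) (τ.norm2_nonneg _))
  rw [mul_pow]
  linarith [hq.1]

theorem norm2_mul_le' (x a : M.Elem) : τ.norm2 (x * a) ≤ ‖a‖ * τ.norm2 x := by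
  rw [← norm2_star, star_mul, ← τ.norm2_star x, ← norm_star a]
  exact τ.norm2_mul_le _ _

theorem norm2_add_le (x y : M.Elem) : τ.norm2 (x + y) ≤ 2 * (τ.norm2 x + τ.norm2 y) := by
  have h : τ.norm2 (x + y) ^ 2 + τ.norm2 (x - y) ^ 2
      = 2 * τ.norm2 x ^ 2 + 2 * τ.norm2 y ^ 2 := by
    simp only [norm2_sq, ← Complex.add_re, ← map_add]
    simp only [star_add, star_sub, add_mul, mul_add, sub_mul, mul_sub, map_add, map_sub,
      Complex.add_re, Complex.sub_re]
    ring
  have hx := τ.norm2_nonneg x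
  have hy := τ.norm2_nonneg y
  refine le_of_sq_le_sq ?_ (by positivity)
  nlinarith [sq_nonneg (τ.norm2 (x - y)), mul_nonneg hx hy]

theorem map_star (x : M.Elem) : τ (star x) = star (τ x) := by
  have h1 := (τ.star_mul_self_pos (1 + x)).2
  have h2 := (τ.star_mul_self_pos (1 + Complex.I • x)).2
  have h3 := (τ.star_mul_self_pos x).2
  simp only [star_add, star_smul, star_one, add_mul, mul_add, map_add, one_mul, mul_one,
    smul_mul_assoc, mul_smul_comm, map_smul, τ.map_one, smul_eq_mul, Complex.add_im,
    Complex.mul_im, Complex.mul_re, Complex.one_im, Complex.I_re, Complex.I_im, h3,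
    Complex.star_def, Complex.conj_I, Complex.neg_re, Complex.neg_im] at h1 h2
  refine Complex.ext ?_ ?_
  · simp only [Complex.star_def, Complex.conj_re]; linarith
  · simp only [Complex.star_def, Complex.conj_im]; linarith

theorem norm_apply_le (x : M.Elem) : ‖τ x‖ ≤ τ.norm2 x := by
  refine le_of_sq_le_sq ?_ (τ.norm2_nonneg x)
  have h := (τ.star_mul_self_pos (x - τ x • 1)).1
  simp only [star_sub, star_smul, star_one, sub_mul, mul_sub, map_sub, mul_one,
    smul_mul_assoc, mul_smul_comm, map_smul, τ.map_one, smul_eq_mul, one_mul, τ.map_star,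
    Complex.star_def] at h
  rw [norm2_sq, Complex.sq_norm, Complex.normSq_apply]
  simp only [Complex.sub_re, Complex.mul_re, Complex.conj_re, Complex.conj_im] at h
  linarith

/-- The algebra `ℓ^∞(I, M)` of families in `M` that are bounded in operator norm. -/
def boundedFamilies (M : VonNeumannAlgebra H) (I : Type u) : StarSubalgebra ℂ (I → M.Elem) where
  carrier := {x | ∃ C : ℝ, ∀ i, ‖x i‖ ≤ C}
  mul_mem' := by
    rintro x y ⟨C, hC⟩ ⟨D, hD⟩
    exact ⟨C * D, fun i => (norm_mul_le _ _).trans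
      (mul_le_mul (hC i) (hD i) (norm_nonneg _) ((norm_nonneg _).trans (hC i)))⟩
  add_mem' := by
    rintro x y ⟨C, hC⟩ ⟨D, hD⟩
    exact ⟨C + D, fun i => (norm_add_le _ _).trans (add_le_add (hC i) (hD i))⟩
  algebraMap_mem' := fun c => ⟨‖algebraMap ℂ M.Elem c‖, fun _ => le_rfl⟩
  star_mem' := by
    rintro x ⟨C, hC⟩
    exact ⟨C, fun i => (norm_star (x i)).trans_le (hC i)⟩

variable {I : Type u} (U : Ultrafilter I)

/-- The ideal of the bounded families `x` with `lim_U ‖x i‖₂ = 0`. -/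
def nullIdeal : Ideal (boundedFamilies M I) where
  carrier := {x | Tendsto (fun i => τ.norm2 (x.1 i)) U (𝓝 0)}
  zero_mem' := by
    simp [norm2_zero]
  add_mem' := by
    intro x y hx hy
    refine squeeze_zero (fun i => τ.norm2_nonneg _) (fun i => τ.norm2_add_le _ _) ?_
    simpa using (Tendsto.add hx hy).const_mul 2
  smul_mem' := by
    rintro ⟨a, C, hC⟩ x hx
    refine squeeze_zero (fun i => τ.norm2_nonneg _)
      (fun i => (τ.norm2_mul_le (a i) (x.1 i)).trans
        (mul_le_mul_of_nonneg_right (hC i) (τ.norm2_nonneg _))) ?_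
    simpa using Tendsto.const_mul C hx

theorem mem_nullIdeal {x : boundedFamilies M I} :
    x ∈ τ.nullIdeal U ↔ Tendsto (fun i => τ.norm2 (x.1 i)) U (𝓝 0) := Iff.rfl

instance : (τ.nullIdeal U).IsTwoSided where
  mul_mem_of_left := by
    rintro x ⟨a, C, hC⟩ hx
    refine squeeze_zero (fun i => τ.norm2_nonneg _)
      (fun i => (τ.norm2_mul_le' (x.1 i) (a i)).trans
        (mul_le_mul_of_nonneg_right (hC i) (τ.norm2_nonneg _))) ?_
    simpa using Tendsto.const_mul C hx

theorem star_mem_nullIdeal {x : boundedFamilies M I} (hx : x ∈ τ.nullIdeal U) :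
    star x ∈ τ.nullIdeal U := by
  rw [mem_nullIdeal] at hx ⊢
  refine hx.congr fun i => ?_
  exact (τ.norm2_star (x.1 i)).symm

/-- The tracial ultrapower `M^U`: bounded families modulo those with `lim_U ‖x i‖₂ = 0`. -/
abbrev Ultrapower : Type u := boundedFamilies M I ⧸ τ.nullIdeal U

/-- The class in `M^U` of a bounded family. -/
abbrev mkU (x : boundedFamilies M I) : τ.Ultrapower U := Ideal.Quotient.mk (τ.nullIdeal U) x

/-- The involution of `M^U`, induced by the pointwise involution of families. -/
instance : StarRing (τ.Ultrapower U) where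
  star := Quotient.map' star (by
    intro x y h
    rw [Submodule.quotientRel_def] at h ⊢
    have e : star x - star y = star (x - y) := (star_sub x y).symm
    exact e ▸ τ.star_mem_nullIdeal U h)
  star_involutive := by
    rintro ⟨x⟩
    exact congrArg (τ.mkU U) (star_star x)
  star_mul := by
    rintro ⟨x⟩ ⟨y⟩
    exact congrArg (τ.mkU U) (star_mul x y)
  star_add := by
    rintro ⟨x⟩ ⟨y⟩
    exact congrArg (τ.mkU U) (star_add x y)

theorem star_mkU (x : boundedFamilies M I) : star (τ.mkU U x) = τ.mkU U (star x) := rfl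

/-- The traces of a bounded family converge along every ultrafilter. -/
theorem tendsto_limUnder (x : boundedFamilies M I) :
    Tendsto (fun i => τ (x.1 i)) U (𝓝 (limUnder (U : Filter I) fun i => τ (x.1 i))) := by
  obtain ⟨C, hC⟩ := x.2
  have hb : ∀ i, τ (x.1 i) ∈ Metric.closedBall (0 : ℂ) C := fun i => by
    rw [mem_closedBall_zero_iff]
    refine (τ.norm_apply_le _).trans ?_
    have h := τ.norm2_mul_le (x.1 i) 1
    have h1 : τ.norm2 1 = 1 := by simp [norm2, τ.map_one]
    rw [mul_one, h1, mul_one] at h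
    exact h.trans (hC i)
  obtain ⟨z, -, hz⟩ := (isCompact_closedBall (0 : ℂ) C).ultrafilter_le_nhds
    (U.map fun i => τ (x.1 i)) (by
      rw [Ultrafilter.coe_map, le_principal_iff, mem_map]
      exact Filter.univ_mem' hb)
  exact tendsto_nhds_limUnder ⟨z, hz⟩

/-- The trace of `M^U`: the class of `x` is sent to `lim_U τ(x i)`. -/
def ultraTrace : τ.Ultrapower U → ℂ :=
  Quotient.lift (fun x : boundedFamilies M I => limUnder (U : Filter I) fun i => τ (x.1 i)) (by
    intro x y h
    have h' : x - y ∈ τ.nullIdeal U := (Submodule.quotientRel_def _).1 h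
    have h0 : Tendsto (fun i => τ (x.1 i) - τ (y.1 i)) U (𝓝 0) := by
      refine squeeze_zero_norm (fun i => ?_) h'
      rw [← map_sub]
      exact τ.norm_apply_le _
    have := tendsto_nhds_unique ((τ.tendsto_limUnder U x).sub (τ.tendsto_limUnder U y)) h0
    exact sub_eq_zero.1 this)

theorem tendsto_ultraTrace (x : boundedFamilies M I) :
    Tendsto (fun i => τ (x.1 i)) U (𝓝 (τ.ultraTrace U (τ.mkU U x))) :=
  τ.tendsto_limUnder U x

/-- The diagonal embedding of `M` into `M^U`. -/
def diagonal (x : M.Elem) : τ.Ultrapower U := τ.mkU U ⟨fun _ => x, ‖x‖, fun _ => le_rfl⟩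

/-- Embeddings of tracial von Neumann algebras: unital `*`-homomorphisms that preserve the trace.
(Such maps are automatically injective and normal.) -/
def Preserves {K : Type u} [NormedAddCommGroup K] [InnerProductSpace ℂ K] [CompleteSpace K]
    {P : VonNeumannAlgebra K} (τ : Trace M) (σ : Trace P) (j : M.Elem →⋆ₐ[ℂ] P.Elem) : Prop :=
  ∀ x, σ (j x) = τ x

/-- The trace on a von Neumann subalgebra `N` of `M` obtained by restriction. -/
def restrict {N : VonNeumannAlgebra H} (hN : N ≤ M) : Trace N where
  toLinearMap := τ.toLinearMap ∘ₗ
    (StarSubalgebra.inclusion (show N.toStarSubalgebra ≤ M.toStarSubalgebra from hN)).toLinearMap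
  map_one := τ.map_one
  pos x hx := τ.pos _ hx
  mul_comm x y := τ.mul_comm ⟨x.1, hN x.2⟩ ⟨y.1, hN y.2⟩
  faithful x hx := by
    have h : (⟨x.1, hN x.2⟩ : M.Elem) = 0 := τ.faithful ⟨x.1, hN x.2⟩ hx
    have h' : x.1 = 0 := congrArg Subtype.val h
    exact Subtype.ext h'
  normal := by
    obtain ⟨ξ, η, h1, h2, h3⟩ := τ.normal
    exact ⟨ξ, η, h1, h2, fun x => h3 ⟨x.1, hN x.2⟩⟩

/-- The tracial von Neumann algebra `(M, τ)` is existentially closed: for every embedding `j` of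
it into a tracial von Neumann algebra `(P, σ)` there is a trace-preserving embedding of `P` into
an ultrapower of `M` that restricts to the diagonal embedding of `M`. -/
def IsExistentiallyClosed : Prop :=
  ∀ (K : Type u) [NormedAddCommGroup K] [InnerProductSpace ℂ K] [CompleteSpace K]
    (P : VonNeumannAlgebra K) (σ : Trace P) (j : M.Elem →⋆ₐ[ℂ] P.Elem), Preserves τ σ j →
    ∃ (I : Type u) (U : Ultrafilter I) (g : P.Elem →⋆ₐ[ℂ] τ.Ultrapower U),
      (∀ y, τ.ultraTrace U (g y) = σ y) ∧ ∀ x, g (j x) = τ.diagonal U x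

/-- `M`, carrying the faithful normal tracial state `τ`, is a II₁ factor: an infinite-dimensional
factor. -/
def IsIIOneFactor (_τ : Trace M) : Prop := M.IsFactor ∧ ¬ FiniteDimensional ℂ M.Elem

/-- Separability of `M` with respect to `‖·‖₂`. -/
def IsSeparable : Prop :=
  ∃ S : Set M.Elem, S.Countable ∧ ∀ (x : M.Elem) (ε : ℝ), 0 < ε → ∃ s ∈ S, τ.norm2 (x - s) < ε

/-- Approximate unitary conjugacy of two maps into `M`. -/
def ApproxUnitarilyConjugate {A : Type u} (f g : A → M.Elem) : Prop :=
  ∀ (F : Finset A) (ε : ℝ), 0 < ε →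
    ∃ v ∈ unitary M.Elem, ∀ x ∈ F, τ.norm2 (v * f x * star v - g x) < ε

/-- An endomorphism is approximately inner if it is the pointwise `‖·‖₂`-limit of a sequence of
inner automorphisms. -/
def IsApproximatelyInner (f : M.Elem → M.Elem) : Prop :=
  ∃ v : ℕ → M.Elem, (∀ n, v n ∈ unitary M.Elem) ∧
    ∀ x, Tendsto (fun n => τ.norm2 (v n * x * star (v n) - f x)) atTop (𝓝 0)

end Trace

end VonNeumannAlgebra

end

/-! ### Unitaries and functional calculus in a C⋆-algebra -/

noncomputable section

section CStarAlgebra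

variable {A : Type*} [CStarAlgebra A]

/-! It is enough to conjugate two arbitrary trace-preserving embeddings `f, g : N → M` inside some
tracial extension of `M`: existential closedness then brings the conjugating element back to `M`,
approximately.

The extension is generated by `M` and an operator-valued circular element. Let `E_f`, `E_g : M → N`
be the adjoints of `f`, `g` for the traces. The maps `g ∘ E_f` and `f ∘ E_g` are unital, completely
positive and adjoint to each other for `τ` (`Preserves.covariance`). Over this pair of maps there is
a full Fock space with creation operators `ℓ(e)`, where `ℓ(e)* b ℓ(e) = η e b`, and the circular
element is `y = ℓ(true) + ℓ(false)*`. Duality of the two maps makes the vacuum a trace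
(`isTracialVector_Ω`), and their module properties over `N` give `f(x) y = y g(x)`
(`rep_mul_circOp`).

The polar part of `y` would be the desired unitary if `y` had no kernel. Since the maps are unital,
Chebyshev polynomials in `y`, `y*` send the vacuum to an orthonormal sequence, and averaging those
of even degree puts `1` in the `‖·‖₂`-closure of `y* y P` (`exists_norm2_one_add_le`). Hence `v = y
(y* y + δ)^(-1/2)` is almost unitary, and it still intertwines because `y* y` commutes with the
image of `g`.

Representing the image of `v` in an ultrapower by a bounded family gives `w` in `M` with `w* w`
close to `1` and `f(x) w` close to `w g(x)` on a finite set. Such a `w` is `‖·‖₂`-close to a unitary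
(`exists_unitary_near`), by truncation and a quantitative Russo–Dye argument. Part (2) is a diagonal
argument over a dense sequence. -/

theorem IsUnit.exists_unitary_mul_sqrt {b : A} (hb : IsUnit b) :
    ∃ w ∈ unitary A, b = w * cfc Real.sqrt (star b * b) := by
  set T : A := star b * b with hT
  have hTsa : IsSelfAdjoint T := IsSelfAdjoint.star_mul_self b
  have hTu : IsUnit T := hb.star.mul hb
  have h0 : ∀ t ∈ spectrum ℝ T, 0 < t := fun t ht => by
    refine lt_of_le_of_ne (spectrum_star_mul_self_nonneg t ht) ?_
    rintro rfl
    exact (spectrum.zero_notMem_iff ℝ).2 hTu ht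
  have hc : ContinuousOn (fun t : ℝ => (√t)⁻¹) (spectrum ℝ T) :=
    Real.continuous_sqrt.continuousOn.inv₀ fun t ht => (Real.sqrt_pos.2 (h0 t ht)).ne'
  have hRS : cfc (fun t : ℝ => (√t)⁻¹) T * cfc Real.sqrt T = 1 := by
    rw [← cfc_mul (fun t : ℝ => (√t)⁻¹) Real.sqrt T hc, ← cfc_one ℝ T]
    exact cfc_congr fun t ht => inv_mul_cancel₀ (Real.sqrt_pos.2 (h0 t ht)).ne'
  have hSR : cfc Real.sqrt T * cfc (fun t : ℝ => (√t)⁻¹) T = 1 := by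
    rw [← hRS]; exact (cfc_commute_cfc _ _ T).eq
  have hSS : cfc Real.sqrt T * cfc Real.sqrt T = T := by
    rw [← cfc_mul Real.sqrt Real.sqrt T]
    conv_rhs => rw [← cfc_id ℝ T]
    exact cfc_congr fun t ht => Real.mul_self_sqrt (h0 t ht).le
  set S := cfc Real.sqrt T
  set R := cfc (fun t : ℝ => (√t)⁻¹) T
  have hRsa : star R = R := (cfc_predicate _ _ : IsSelfAdjoint R).star_eq
  have hW : star (b * R) * (b * R) = 1 := by
    rw [star_mul, hRsa, mul_assoc, ← mul_assoc (star b), ← hT, ← hSS, mul_assoc S, hSR, mul_one,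
      hRS]
  have hWu : IsUnit (b * R) := hb.mul ⟨⟨R, S, hRS, hSR⟩, rfl⟩
  refine ⟨b * R, Unitary.mem_iff.2 ⟨hW, ?_⟩, ?_⟩
  · refine hWu.mul_right_cancel ?_
    rw [mul_assoc, hW, mul_one, one_mul]
  · rw [mul_assoc, hRS, mul_one]

/-- Half of `1 + u* a` is an invertible contraction, so it is `W S` with `W` unitary and `S` a
self-adjoint contraction, and `S` is the mean of the unitaries `S ± i √(1 - S²)`. -/
theorem exists_unitary_add_unitary_eq {a u : A} (ha : ‖a‖ < 1) (hu : u ∈ unitary A) :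
    ∃ w ∈ unitary A, ∃ u' ∈ unitary A, u + a = w + u' := by
  let _ := CStarAlgebra.spectralOrder A
  have _ := CStarAlgebra.spectralOrderedRing A
  obtain hs | hs := subsingleton_or_nontrivial A
  · exact ⟨1, one_mem _, 1, one_mem _, Subsingleton.elim _ _⟩
  have hu1 := Unitary.mem_iff.1 hu
  have hc : ‖star u * a‖ < 1 := by
    rwa [CStarRing.norm_coe_unitary_mul ⟨star u, Unitary.star_mem hu⟩ a]
  have h1c : IsUnit (1 + star u * a) := by
    have := isUnit_one_sub_of_norm_lt_one (x := -(star u * a)) (by rwa [norm_neg])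
    rwa [sub_neg_eq_add] at this
  set b : A := (2⁻¹ : ℂ) • (1 + star u * a) with hb
  have hbu : IsUnit b := by
    have : b = algebraMap ℂ A 2⁻¹ * (1 + star u * a) := by rw [hb, Algebra.smul_def]
    rw [this]
    exact ((IsUnit.mk0 (2⁻¹ : ℂ) (by norm_num)).map (algebraMap ℂ A)).mul h1c
  have hbn : ‖b‖ ≤ 1 := by
    rw [hb, norm_smul]
    have := norm_add_le (1 : A) (star u * a)
    rw [norm_one] at this
    norm_num
    linarith
  obtain ⟨W, hW, hbW⟩ := hbu.exists_unitary_mul_sqrt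
  set S := cfc Real.sqrt (star b * b)
  have hSsa : IsSelfAdjoint S := cfc_predicate _ _
  have hSn : ‖S‖ ≤ 1 := by
    rw [hbW, CStarRing.norm_coe_unitary_mul ⟨W, hW⟩ S] at hbn
    exact hbn
  have hs := hSsa.self_add_I_smul_cfcSqrt_sub_sq_mem_unitary S hSn
  set s := S + Complex.I • CFC.sqrt (1 - S ^ 2)
  have hsS : s + star s = (2 : ℂ) • S := by
    simp only [s, star_add, hSsa.star_eq, star_smul, Complex.star_def, Complex.conj_I,
      (CFC.sqrt_nonneg (1 - S ^ 2 : A)).isSelfAdjoint.star_eq, neg_smul, two_smul]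
    abel
  refine ⟨u * W * s, mul_mem (mul_mem hu hW) hs, u * W * star s,
    mul_mem (mul_mem hu hW) (Unitary.star_mem hs), ?_⟩
  rw [← mul_add, hsS, mul_smul_comm, mul_assoc, ← hbW, hb, mul_smul_comm, smul_smul]
  norm_num
  rw [mul_add, mul_one, ← mul_assoc, hu1.2, one_mul]

/-- A quantitative form of the Russo–Dye theorem. -/
theorem exists_unitary_sum_eq {a : A} (ha : ‖a‖ < 1) (n : ℕ) :
    ∃ w : ℕ → A, (∀ k, w k ∈ unitary A) ∧ ∃ u ∈ unitary A,
      1 + (n : ℂ) • a = (∑ k ∈ Finset.range n, w k) + u := by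
  induction n with
  | zero => exact ⟨fun _ => 1, fun _ => one_mem _, 1, one_mem _, by simp⟩
  | succ n ih =>
    obtain ⟨w, hw, u, hu, h⟩ := ih
    -- One more copy of `a` is absorbed by the spare unitary `u`, which is replaced by a new summand
    -- and a new spare unitary. Values of `w` at indices `≥ n` are irrelevant.
    obtain ⟨w', hw', u', hu', h'⟩ := exists_unitary_add_unitary_eq ha hu
    refine ⟨fun k => if k = n then w' else w k, fun k => ?_, u', hu', ?_⟩
    · dsimp only; split_ifs
      exacts [hw', hw k]
    · rw [Finset.sum_range_succ, if_pos rfl, add_assoc, ← h', ← add_assoc,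
        Finset.sum_congr rfl fun k hk => if_neg (Finset.mem_range.1 hk).ne, ← h]
      push_cast
      rw [add_smul, one_smul, add_assoc]

/-- Reduces estimates on `v g(v* v)` to scalar inequalities on the spectrum of `v* v`. -/
theorem star_mul_cfc_mul_mul_cfc (v : A) {g : ℝ → ℝ}
    (hg : ContinuousOn g (spectrum ℝ (star v * v))) :
    star (v * cfc g (star v * v)) * (v * cfc g (star v * v))
      = cfc (fun t => g t * (t * g t)) (star v * v) := by
  rw [star_mul, (cfc_predicate _ _ : IsSelfAdjoint (cfc g (star v * v))).star_eq, mul_assoc,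
    ← mul_assoc (star v), cfc_mul g (fun t => t * g t) _ hg (continuousOn_id.mul hg),
    cfc_mul (fun t => t) g _ continuousOn_id hg, cfc_id' ℝ (star v * v)]

end CStarAlgebra

/-! ### Trace-norm estimates and the approximation of almost unitary elements by unitaries -/

namespace VonNeumannAlgebra

variable {H : Type u} [NormedAddCommGroup H] [InnerProductSpace ℂ H] [CompleteSpace H]

instance (M : VonNeumannAlgebra H) :
    IsClosed (M.toStarSubalgebra : Set (H →L[ℂ] H)) := by
  rw [coe_toStarSubalgebra, ← M.centralizer_centralizer]
  exact Set.isClosed_centralizer _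

instance (M : VonNeumannAlgebra H) : CStarAlgebra M.Elem :=
  StarSubalgebra.cstarAlgebra M.toStarSubalgebra

namespace Trace

variable {M : VonNeumannAlgebra H} (τ : Trace M)

/-- The pre-inner product `⟨x, y⟩ = τ(x* y)`. -/
@[reducible]
def innerCore : PreInnerProductSpace.Core ℂ M.Elem where
  inner x y := τ (star x * y)
  conj_inner_symm x y := by
    rw [← Complex.star_def, ← τ.map_star, star_mul, star_star]
  re_inner_nonneg x := (τ.star_mul_self_pos x).1
  add_left x y z := by rw [star_add, add_mul, map_add]
  smul_left x y r := by
    rw [star_smul, smul_mul_assoc, map_smul, smul_eq_mul, Complex.star_def]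

theorem norm_apply_star_mul_le (x y : M.Elem) :
    ‖τ (star x * y)‖ ≤ τ.norm2 x * τ.norm2 y :=
  InnerProductSpace.Core.norm_inner_le_norm (c := τ.innerCore) x y

theorem norm_apply_mul_le (x y : M.Elem) : ‖τ (x * y)‖ ≤ τ.norm2 x * τ.norm2 y := by
  simpa [τ.norm2_star] using τ.norm_apply_star_mul_le (star x) y

theorem norm2_add (x y : M.Elem) : τ.norm2 (x + y) ≤ τ.norm2 x + τ.norm2 y :=
  letI := InnerProductSpace.Core.toSeminormedAddCommGroup (c := τ.innerCore)
  norm_add_le x y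

theorem norm2_neg (x : M.Elem) : τ.norm2 (-x) = τ.norm2 x := by simp [norm2]

theorem norm2_sub (x y : M.Elem) : τ.norm2 (x - y) ≤ τ.norm2 x + τ.norm2 y := by
  rw [sub_eq_add_neg, ← τ.norm2_neg y]; exact τ.norm2_add _ _

theorem norm2_one : τ.norm2 1 = 1 := by simp [norm2, τ.map_one]

theorem norm2_le_norm (x : M.Elem) : τ.norm2 x ≤ ‖x‖ := by
  simpa [norm2_one] using τ.norm2_mul_le x 1

theorem norm2_unitary {u : M.Elem} (hu : u ∈ unitary M.Elem) : τ.norm2 u = 1 := by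
  simp [norm2, (Unitary.mem_iff.1 hu).1, τ.map_one]

theorem norm2_unitary_mul {u : M.Elem} (hu : u ∈ unitary M.Elem) (x : M.Elem) :
    τ.norm2 (u * x) = τ.norm2 x := by
  rw [norm2, star_mul, mul_assoc, ← mul_assoc (star u), (Unitary.mem_iff.1 hu).1, one_mul, norm2]

theorem norm2_mul_unitary {u : M.Elem} (hu : u ∈ unitary M.Elem) (x : M.Elem) :
    τ.norm2 (x * u) = τ.norm2 x := by
  rw [← norm2_star, star_mul, τ.norm2_unitary_mul (Unitary.star_mem hu), norm2_star]

theorem norm2_eq_zero_iff {x : M.Elem} : τ.norm2 x = 0 ↔ x = 0 := by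
  refine ⟨fun h => τ.faithful x (Complex.ext ?_ (τ.star_mul_self_pos x).2), fun h => ?_⟩
  · rw [← norm2_sq, h]; simp
  · rw [h, norm2_zero]

theorem norm2_sub_sq (x y : M.Elem) :
    τ.norm2 (x - y) ^ 2 = τ.norm2 x ^ 2 + τ.norm2 y ^ 2 - 2 * (τ (star x * y)).re := by
  have h : τ (star y * x) = star (τ (star x * y)) := by rw [← τ.map_star, star_mul, star_star]
  simp only [norm2_sq, star_sub, sub_mul, mul_sub, map_sub, h, Complex.sub_re, Complex.star_def,
    Complex.conj_re]
  ring

theorem re_cfc_nonneg {T : M.Elem} {g : ℝ → ℝ}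
    (hg : ContinuousOn g (spectrum ℝ T)) (h0 : ∀ t ∈ spectrum ℝ T, 0 ≤ g t) :
    0 ≤ (τ (cfc g T)).re := by
  have : cfc g T = star (cfc (fun t => √(g t)) T) * cfc (fun t => √(g t)) T := by
    have hc : ContinuousOn (fun t => √(g t)) (spectrum ℝ T) := hg.sqrt
    rw [(cfc_predicate _ _ : IsSelfAdjoint (cfc (fun t => √(g t)) T)).star_eq, ← cfc_mul _ _ T hc hc]
    exact cfc_congr fun t ht => (Real.mul_self_sqrt (h0 t ht)).symm
  rw [this]
  exact (τ.star_mul_self_pos _).1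

theorem re_cfc_mono {T : M.Elem} {g h : ℝ → ℝ}
    (hg : ContinuousOn g (spectrum ℝ T)) (hh : ContinuousOn h (spectrum ℝ T))
    (h0 : ∀ t ∈ spectrum ℝ T, g t ≤ h t) : (τ (cfc g T)).re ≤ (τ (cfc h T)).re := by
  have := τ.re_cfc_nonneg (g := fun t => h t - g t) (hh.sub hg)
    fun t ht => sub_nonneg.2 (h0 t ht)
  rw [cfc_sub _ _ T hh hg, map_sub, Complex.sub_re] at this
  linarith

theorem norm2_sq_cfc {T : M.Elem} {g : ℝ → ℝ} (hg : ContinuousOn g (spectrum ℝ T)) :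
    τ.norm2 (cfc g T) ^ 2 = (τ (cfc (fun t => g t ^ 2) T)).re := by
  rw [norm2_sq, (cfc_predicate _ _ : IsSelfAdjoint (cfc g T)).star_eq, ← cfc_mul _ _ T hg hg]
  simp only [sq]

/-- Truncation of an element whose square modulus is close to `1` to a contraction. -/
theorem exists_contraction_near (v : M.Elem) : ∃ w : M.Elem, ‖w‖ ≤ 1 ∧
    τ.norm2 (w - v) ≤ τ.norm2 (star v * v - 1) ∧
    τ.norm2 (star w * w - 1) ≤ τ.norm2 (star v * v - 1) := by
  set T : M.Elem := star v * v with hT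
  have hTsa : IsSelfAdjoint T := IsSelfAdjoint.star_mul_self v
  have hT0 : ∀ t ∈ spectrum ℝ T, 0 ≤ t := spectrum_star_mul_self_nonneg
  have hm : ∀ t : ℝ, 1 ≤ √(max 1 t) := fun t => Real.one_le_sqrt.2 (le_max_left _ _)
  have hc : Continuous fun t : ℝ => (√(max 1 t))⁻¹ :=
    Continuous.inv₀ (by fun_prop) fun t => by have := hm t; positivity
  have hsub : cfc (fun t : ℝ => t - 1) T = T - 1 := by
    rw [cfc_sub (fun t : ℝ => t) (fun _ => 1) T, cfc_id' ℝ T, cfc_const_one ℝ T]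
  have hrhs : τ.norm2 (T - 1) ^ 2 = (τ (cfc (fun t : ℝ => (t - 1) ^ 2) T)).re := by
    rw [← hsub, τ.norm2_sq_cfc (by fun_prop)]
  -- With this `k` the square modulus of `v k` is `min(T, 1)`: the modulus of `v` is cut off at `1`.
  -- The two estimates below are `(s - 1)² ≤ (s² - 1)²` for `s = √t ≥ 1`, and a comparison of
  -- `min(t, 1) - 1` with `t - 1`.
  set k : M.Elem := cfc (fun t : ℝ => (√(max 1 t))⁻¹) T
  have hww : star (v * k) * (v * k) = cfc (fun t : ℝ => t / max 1 t) T := by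
    rw [star_mul_cfc_mul_mul_cfc v hc.continuousOn]
    refine cfc_congr fun t _ => ?_
    have h1 : 0 < max 1 t := lt_max_of_lt_left one_pos
    have := Real.mul_self_sqrt h1.le
    have h2 := hm t
    field_simp
    rw [sq, this, _root_.mul_comm]
  have hcd : Continuous fun t : ℝ => t / max 1 t :=
    continuous_id.div (by fun_prop) fun t => (lt_max_of_lt_left one_pos).ne'
  refine ⟨v * k, ?_, ?_, ?_⟩
  · have h1 : ‖star (v * k) * (v * k)‖ ≤ 1 := by
      rw [hww]
      refine norm_cfc_le zero_le_one fun t ht => ?_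
      rw [Real.norm_of_nonneg (div_nonneg (hT0 t ht) (zero_le_one.trans (le_max_left _ _)))]
      exact div_le_one_of_le₀ (le_max_right _ _) (zero_le_one.trans (le_max_left _ _))
    rw [CStarRing.norm_star_mul_self] at h1
    nlinarith [norm_nonneg (v * k)]
  · refine le_of_sq_le_sq ?_ (τ.norm2_nonneg _)
    have e : star (v * k - v) * (v * k - v)
        = cfc (fun t : ℝ => t * ((√(max 1 t))⁻¹ - 1) ^ 2) T := by
      have h1 : v * k - v = v * cfc (fun t : ℝ => (√(max 1 t))⁻¹ - 1) T := by
        rw [cfc_sub _ _ T hc.continuousOn (by fun_prop), cfc_const_one ℝ T, mul_sub, mul_one]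
      have hc1 : Continuous fun t : ℝ => (√(max 1 t))⁻¹ - 1 := hc.sub continuous_const
      rw [h1, star_mul_cfc_mul_mul_cfc v hc1.continuousOn]
      refine cfc_congr fun t _ => ?_
      ring
    rw [hrhs, norm2_sq, e]
    refine τ.re_cfc_mono (by fun_prop) (by fun_prop) fun t ht => ?_
    rcases le_total t 1 with h | h
    · rw [max_eq_left h]; simp; positivity
    · rw [max_eq_right h]
      obtain ⟨s, hs, rfl⟩ : ∃ s : ℝ, 1 ≤ s ∧ t = s ^ 2 :=
        ⟨√t, Real.one_le_sqrt.2 h, (Real.sq_sqrt (hT0 t ht)).symm⟩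
      rw [Real.sqrt_sq (by linarith)]
      have : s ^ 2 * (s⁻¹ - 1) ^ 2 = (s - 1) ^ 2 := by field_simp; ring
      rw [this]
      have h3 : s - 1 ≤ s ^ 2 - 1 := by nlinarith
      nlinarith
  · refine le_of_sq_le_sq ?_ (τ.norm2_nonneg _)
    have e : star (v * k) * (v * k) - 1 = cfc (fun t : ℝ => t / max 1 t - 1) T := by
      rw [cfc_sub _ _ T hcd.continuousOn (by fun_prop), cfc_const_one ℝ T, hww]
    have hcd' : Continuous fun t : ℝ => t / max 1 t - 1 := hcd.sub continuous_const
    rw [hrhs, e, τ.norm2_sq_cfc hcd'.continuousOn]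
    refine τ.re_cfc_mono (hcd'.pow 2).continuousOn (by fun_prop) fun t ht => ?_
    rcases le_total t 1 with h | h
    · rw [max_eq_left h, div_one]
    · rw [max_eq_right h, div_self (by linarith)]; simp; positivity

/-- A contraction of almost full trace norm is close to a unitary. -/
theorem exists_unitary_near_of_norm_lt_one {a : M.Elem} (ha : ‖a‖ < 1) {n : ℕ} (hn : 0 < n) :
    ∃ u ∈ unitary M.Elem, τ.norm2 (u - a) ^ 2 ≤ 1 - τ.norm2 a ^ 2 + 4 / n := by
  obtain ⟨w, hw, u, hu, h⟩ := exists_unitary_sum_eq ha n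
  have hn' : (0 : ℝ) < n := Nat.cast_pos.2 hn
  -- Pairing `1 + n a = ∑ w k + u` with `a` gives `n ‖a‖₂² = ∑ Re τ(a* w k)` up to an error of at
  -- most `2`, so some `w k` satisfies `Re τ(a* w k) ≥ ‖a‖₂² - 2/n`. Expanding `‖w k - a‖₂²` doubles
  -- this error to `4/n`.
  have h1 := congrArg (fun z => (τ (star a * z)).re) h
  simp only [mul_add, mul_one, mul_smul_comm, map_add, map_smul, smul_eq_mul, Complex.add_re,
    Finset.mul_sum, map_sum, Complex.re_sum] at h1
  rw [← Complex.ofReal_natCast, Complex.re_ofReal_mul, ← norm2_sq] at h1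
  have ha1 : τ.norm2 a ≤ 1 := (τ.norm2_le_norm a).trans ha.le
  have hb : ∀ z : M.Elem, τ.norm2 z = 1 → |(τ (star a * z)).re| ≤ 1 := fun z hz => by
    refine (Complex.abs_re_le_norm _).trans ((τ.norm_apply_star_mul_le a z).trans ?_)
    rw [hz, mul_one]; exact ha1
  have h2 := abs_le.1 (hb u (τ.norm2_unitary hu))
  have h3 := abs_le.1 (hb 1 τ.norm2_one)
  rw [mul_one] at h3
  have h4 : ∃ k ∈ Finset.range n, τ.norm2 a ^ 2 - 2 / n ≤ (τ (star a * w k)).re := by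
    by_contra! hcon
    have h5 := Finset.sum_lt_sum_of_nonempty (Finset.nonempty_range_iff.2 hn.ne') hcon
    rw [Finset.sum_const, Finset.card_range, nsmul_eq_mul, mul_sub, mul_div_cancel₀ _ hn'.ne'] at h5
    linarith
  obtain ⟨k, -, hk⟩ := h4
  refine ⟨w k, hw k, ?_⟩
  rw [← norm2_neg, neg_sub, norm2_sub_sq, τ.norm2_unitary (hw k)]
  have : (4 : ℝ) / n = 2 * (2 / n) := by ring
  rw [this]
  linarith

theorem exists_unitary_near (v : M.Elem) {ε : ℝ} (hε : 0 < ε)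
    (h : τ.norm2 (star v * v - 1) ≤ ε ^ 2) (hε1 : ε ≤ 1) :
    ∃ u ∈ unitary M.Elem, τ.norm2 (u - v) ≤ 5 * ε := by
  obtain ⟨w, hw1, hwv, hww⟩ := τ.exists_contraction_near v
  obtain ⟨n, hn⟩ := exists_nat_gt (4 / ε ^ 2)
  have hn0 : 0 < n := by
    have : (0 : ℝ) < n := lt_trans (by positivity) hn
    exact_mod_cast this
  have hn' : 4 / (n : ℝ) ≤ ε ^ 2 := by
    have : (0 : ℝ) < n := Nat.cast_pos.2 hn0
    rw [div_lt_iff₀ (by positivity)] at hn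
    rw [div_le_iff₀ this]; linarith
  -- Averaging over unitaries needs norm strictly below `1`, hence the factor `s`; it costs little,
  -- since `s² ≥ 1 - ε²`. The resulting unitary is within `2 ε` of `s w`, because `1 - (1 - ε²)² +
  -- ε² ≤ 4 ε²`.
  set s : ℝ := 1 - ε ^ 2 / 2
  have hs0 : 0 ≤ s := by simp only [s]; nlinarith
  have hs1 : s < 1 := by simp only [s]; nlinarith [pow_pos hε 2]
  have hnorm : ‖(s : ℂ) • w‖ < 1 := by
    rw [norm_smul, Complex.norm_real, Real.norm_of_nonneg hs0]
    nlinarith [norm_nonneg w]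
  have hn2 : τ.norm2 ((s : ℂ) • w) ^ 2 = s ^ 2 * τ.norm2 w ^ 2 := by
    simp only [norm2_sq, star_smul, smul_mul_assoc, mul_smul_comm, map_smul, smul_eq_mul,
      Complex.star_def, Complex.conj_ofReal, Complex.re_ofReal_mul]
    ring
  obtain ⟨u, hu, huw⟩ := τ.exists_unitary_near_of_norm_lt_one hnorm hn0
  refine ⟨u, hu, ?_⟩
  have hw2 : 1 - ε ^ 2 ≤ τ.norm2 w ^ 2 := by
    have h1 := ((Complex.abs_re_le_norm _).trans (τ.norm_apply_le (star w * w - 1))).trans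
      (hww.trans h)
    rw [map_sub, τ.map_one, Complex.sub_re, Complex.one_re, ← norm2_sq] at h1
    linarith [(abs_le.1 h1).1]
  have h5 : τ.norm2 (u - (s : ℂ) • w) ≤ 2 * ε := by
    refine le_of_sq_le_sq ?_ (by positivity)
    rw [hn2] at huw
    have : (1 - ε ^ 2) * (1 - ε ^ 2) ≤ s ^ 2 * τ.norm2 w ^ 2 := by
      refine mul_le_mul ?_ hw2 (by nlinarith) (sq_nonneg _)
      simp only [s]; nlinarith [sq_nonneg (ε ^ 2)]
    nlinarith [sq_nonneg (ε ^ 2)]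
  have h6 : τ.norm2 ((s : ℂ) • w - w) ≤ ε ^ 2 := by
    have : (s : ℂ) • w - w = ((s - 1 : ℝ) : ℂ) • w := by push_cast; rw [sub_smul, one_smul]
    rw [this]
    refine (τ.norm2_le_norm _).trans ?_
    rw [norm_smul, Complex.norm_real, Real.norm_of_nonpos (by linarith)]
    have : -(s - 1) = ε ^ 2 / 2 := by simp only [s]; ring
    rw [this]
    nlinarith [norm_nonneg w, sq_nonneg ε]
  have e : u - v = (u - (s : ℂ) • w) + (((s : ℂ) • w - w) + (w - v)) := by abel
  rw [e]
  have h7 := τ.norm2_add (u - (s : ℂ) • w) (((s : ℂ) • w - w) + (w - v))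
  have h8 := τ.norm2_add ((s : ℂ) • w - w) (w - v)
  have h9 : ε ^ 2 ≤ ε := by nlinarith
  linarith [hwv.trans h]

end Trace

end VonNeumannAlgebra

end

/-! ### Gram matrices over a C⋆-algebra and weak limits of bounded families -/

noncomputable section

/-- A self-adjoint element `B` has a square root as soon as the cube of its negative part, a
quantity of the form `-n B n`, vanishes. -/
theorem IsSelfAdjoint.exists_mul_mul_eq_neg_sq {A : Type*} [CStarAlgebra A] {B : A}
    (hB : IsSelfAdjoint B) : ∃ n r : A, IsSelfAdjoint n ∧ IsSelfAdjoint r ∧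
      n * B * n = -(r * r) ∧ (r = 0 → ∃ c : A, IsSelfAdjoint c ∧ c * c = B) := by
  -- `m` is the negative part of a number; `n = m(B)` and `r = m(B)^(3/2)`. If `r = 0`, the spectrum
  -- of `B` is nonnegative.
  set m : ℝ → ℝ := fun s => max (-s) 0 with hm
  have hm0 : ∀ s, 0 ≤ m s := fun s => le_max_right _ _
  have hmc : Continuous m := by fun_prop
  refine ⟨cfc m B, cfc (fun s => m s * √(m s)) B, cfc_predicate _ _, cfc_predicate _ _, ?_,
    fun h => ⟨cfc Real.sqrt B, cfc_predicate _ _, ?_⟩⟩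
  · have e : cfc m B * B * cfc m B = cfc (fun s => m s * s * m s) B := by
      rw [cfc_mul (fun s => m s * s) m B, cfc_mul m (fun s => s) B, cfc_id' ℝ B]
    rw [e, ← cfc_mul _ _ B, ← cfc_neg]
    refine cfc_congr fun s _ => ?_
    have h1 : m s * √(m s) * (m s * √(m s)) = m s * m s * m s := by
      linear_combination m s * m s * Real.mul_self_sqrt (hm0 s)
    rw [h1]
    simp only [hm]
    rcases le_total (-s) 0 with h | h
    · rw [max_eq_right h]; ring
    · rw [max_eq_left h]; ring
  · rw [← cfc_const_zero ℝ B] at h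
    have hspec : ∀ s ∈ spectrum ℝ B, 0 ≤ s := fun s hs => by
      have h2 : m s * √(m s) = 0 := (cfc_eq_cfc_iff_eqOn (R := ℝ) (a := B)).1 h hs
      by_contra! hneg
      have : 0 < m s := lt_max_of_lt_left (by linarith)
      have := mul_pos this (Real.sqrt_pos.2 this)
      linarith
    rw [← cfc_mul Real.sqrt Real.sqrt B]
    conv_rhs => rw [← cfc_id ℝ B]
    exact cfc_congr fun s hs => Real.mul_self_sqrt (hspec s hs)

/-- A matrix over a C⋆-algebra that is positive with respect to a faithful positive functional is
a Gram matrix. -/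
theorem exists_gram_of_nonneg {A : Type*} [CStarAlgebra A] (t : A →ₗ[ℂ] ℂ)
    (ht : ∀ x, 0 ≤ (t (star x * x)).re) (hf : ∀ x, (t (star x * x)).re = 0 → x = 0)
    {ι : Type*} [Fintype ι] (Z : ι → ι → A) (hZ : ∀ i j, star (Z i j) = Z j i)
    (hpos : ∀ x : ι → A, 0 ≤ (∑ i, ∑ j, t (star (x i) * Z i j * x j)).re) :
    ∃ d : ι → ι → A, ∀ i j, Z i j = ∑ k, star (d k i) * d k j := by
  classical
  let _ := CStarAlgebra.spectralOrder A
  have _ := CStarAlgebra.spectralOrderedRing A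
  set B : CStarMatrix ι ι A := CStarMatrix.ofMatrix (Matrix.of Z) with hB
  have hBsa : IsSelfAdjoint B := by
    ext i j
    simp [hB, CStarMatrix.star_apply, hZ]
  have hentry : ∀ {c : CStarMatrix ι ι A}, IsSelfAdjoint c → ∀ i j, star (c i j) = c j i := by
    intro c hc i j
    rw [← CStarMatrix.star_apply, hc.star_eq]
  obtain ⟨n, r, hnsa, hrsa, hnBn, hroot⟩ := hBsa.exists_mul_mul_eq_neg_sq
  -- The positivity hypothesis, applied to the columns of `n`, makes the trace of `n B n = -r²`
  -- nonnegative. That of `r²` is nonnegative as well, so both vanish and faithfulness gives `r =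
  -- 0`.
  have hle : 0 ≤ (∑ k, t ((n * B * n) k k)).re := by
    rw [Complex.re_sum]
    refine Finset.sum_nonneg fun k _ => ?_
    refine (hpos fun i => n i k).trans_eq (congrArg Complex.re (Eq.symm ?_))
    rw [CStarMatrix.mul_apply, map_sum, Finset.sum_comm]
    refine Finset.sum_congr rfl fun j _ => ?_
    rw [CStarMatrix.mul_apply, Finset.sum_mul, map_sum]
    refine Finset.sum_congr rfl fun i _ => ?_
    rw [hentry hnsa]
    rfl
  have hsum : ∑ k, ∑ i, (t (star (r i k) * r i k)).re = 0 := by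
    refine le_antisymm ?_ (Finset.sum_nonneg fun k _ => Finset.sum_nonneg fun i _ => ht _)
    rw [hnBn] at hle
    simp only [CStarMatrix.neg_apply, map_neg, Finset.sum_neg_distrib, Complex.neg_re] at hle
    have e : (∑ k, t ((r * r) k k)).re = ∑ k, ∑ i, (t (star (r i k) * r i k)).re := by
      rw [Complex.re_sum]
      refine Finset.sum_congr rfl fun k _ => ?_
      rw [CStarMatrix.mul_apply, map_sum, Complex.re_sum]
      exact Finset.sum_congr rfl fun i _ => by rw [hentry hrsa]
    linarith
  have hr0 : r = 0 := by
    ext i k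
    rw [Finset.sum_eq_zero_iff_of_nonneg
      fun k _ => Finset.sum_nonneg fun i _ => ht _] at hsum
    have := hsum k (Finset.mem_univ _)
    rw [Finset.sum_eq_zero_iff_of_nonneg fun i _ => ht _] at this
    exact hf _ (this i (Finset.mem_univ _))
  obtain ⟨c, hcsa, hcc⟩ := hroot hr0
  refine ⟨fun k i => c k i, fun i j => ?_⟩
  have : Z i j = (c * c) i j := by rw [hcc]; rfl
  rw [this, CStarMatrix.mul_apply]
  exact Finset.sum_congr rfl fun k _ => by rw [hentry hcsa]

namespace VonNeumannAlgebra

variable {H : Type u} [NormedAddCommGroup H] [InnerProductSpace ℂ H] [CompleteSpace H]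

/-- Bounded families of operators have limits in the weak operator topology along ultrafilters. -/
theorem _root_.ContinuousLinearMap.exists_tendsto_inner {ι : Type*} (U : Ultrafilter ι)
    (n : ι → H →L[ℂ] H) {C : ℝ} (hn : ∀ i, ‖n i‖ ≤ C) :
    ∃ m : H →L[ℂ] H, ∀ v w, Tendsto (fun i => inner ℂ v (n i w)) U (𝓝 (inner ℂ v (m w))) := by
  have hb : ∀ v w i, ‖inner ℂ (n i v) w‖ ≤ C * ‖v‖ * ‖w‖ := fun v w i =>
    (norm_inner_le_norm _ _).trans (mul_le_mul_of_nonneg_right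
      ((n i).le_of_opNorm_le (hn i) v) (norm_nonneg _))
  have hlim : ∀ v w, ∃ z, Tendsto (fun i => inner ℂ (n i v) w) U (𝓝 z) ∧
      ‖z‖ ≤ C * ‖v‖ * ‖w‖ := fun v w => by
    obtain ⟨z, hz, h⟩ := (isCompact_closedBall (0 : ℂ) (C * ‖v‖ * ‖w‖)).ultrafilter_le_nhds
      (U.map fun i => inner ℂ (n i v) w) (by
        rw [Ultrafilter.coe_map, le_principal_iff, mem_map]
        exact Filter.univ_mem' fun i => mem_closedBall_zero_iff.2 (hb v w i))
    exact ⟨z, h, mem_closedBall_zero_iff.1 hz⟩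
  choose b hb1 hb2 using hlim
  let B : H →L⋆[ℂ] H →L[ℂ] ℂ := LinearMap.mkContinuous₂
    (LinearMap.mk₂'ₛₗ (starRingEnd ℂ) (RingHom.id ℂ) b
      (fun v v' w => tendsto_nhds_unique (hb1 _ _) (by
        simpa only [map_add, inner_add_left] using (hb1 v w).add (hb1 v' w)))
      (fun c v w => tendsto_nhds_unique (hb1 _ _) (by
        simpa only [map_smul, inner_smul_left, smul_eq_mul] using (hb1 v w).const_mul _))
      (fun v w w' => tendsto_nhds_unique (hb1 _ _) (by
        simpa only [map_add, inner_add_right] using (hb1 v w).add (hb1 v w')))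
      (fun c v w => tendsto_nhds_unique (hb1 _ _) (by
        simpa only [map_smul, inner_smul_right, smul_eq_mul, RingHom.id_apply]
          using (hb1 v w).const_mul _)))
    C (fun v w => hb2 v w)
  refine ⟨InnerProductSpace.continuousLinearMapOfBilin B, fun v w => ?_⟩
  have h1 : inner ℂ (InnerProductSpace.continuousLinearMapOfBilin B w) v = b w v :=
    InnerProductSpace.continuousLinearMapOfBilin_apply B w v
  have h2 := (Complex.continuous_conj.tendsto _).comp (hb1 w v)
  rw [← h1, inner_conj_symm] at h2
  refine h2.congr fun i => ?_
  simp [inner_conj_symm]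

namespace Trace

variable {M : VonNeumannAlgebra H} (τ : Trace M)

/-- Weak compactness of balls of `M`. A weak operator limit stays in the bicommutant `M`. By
normality the trace is a sum of vector functionals, and dominated convergence passes the limit
through this sum. -/
theorem exists_tendsto_apply_mul {ι : Type*} (U : Ultrafilter ι) (n : ι → M.Elem) {C : ℝ}
    (hn : ∀ i, ‖n i‖ ≤ C) :
    ∃ m : M.Elem, ∀ x, Tendsto (fun i => τ (n i * x)) U (𝓝 (τ (m * x))) := by
  obtain ⟨m, hm⟩ := ContinuousLinearMap.exists_tendsto_inner U (fun i => (n i : H →L[ℂ] H)) hn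
  have hmem : m ∈ M := by
    rw [← SetLike.mem_coe, ← M.centralizer_centralizer]
    intro y hy
    refine ContinuousLinearMap.ext fun w => ext_inner_left ℂ fun v => ?_
    have h1 := hm v (y w)
    have h2 := hm (ContinuousLinearMap.adjoint y v) w
    rw [ContinuousLinearMap.adjoint_inner_left] at h2
    refine tendsto_nhds_unique (h2.congr fun i => ?_) h1
    rw [ContinuousLinearMap.adjoint_inner_left]
    exact congrArg (inner ℂ v) (congrArg (fun z : H →L[ℂ] H => z w) (hy (n i) (n i).2)).symm
  refine ⟨⟨m, hmem⟩, fun x => ?_⟩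
  obtain ⟨ξ, η, hξ, hη, hτ⟩ := τ.normal
  have key := tendsto_tsum_of_dominated_convergence (𝓕 := (U : Filter ι))
    (f := fun i k => inner ℂ (η k) ((n i : H →L[ℂ] H) ((x : H →L[ℂ] H) (ξ k))))
    (g := fun k => inner ℂ (η k) (m ((x : H →L[ℂ] H) (ξ k))))
    (bound := fun k => C * ‖(x : H →L[ℂ] H)‖ * (‖ξ k‖ ^ 2 + ‖η k‖ ^ 2)) ((hξ.add hη).mul_left _)
    (fun k => hm _ _) (Eventually.of_forall fun i k => ?_)
  · rw [(hτ (⟨m, hmem⟩ * x)).tsum_eq.symm]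
    exact key.congr fun i => (hτ (n i * x)).tsum_eq
  · have hC : 0 ≤ C := (norm_nonneg _).trans (hn i)
    calc ‖inner ℂ (η k) ((n i : H →L[ℂ] H) ((x : H →L[ℂ] H) (ξ k)))‖
        ≤ ‖η k‖ * (C * (‖(x : H →L[ℂ] H)‖ * ‖ξ k‖)) := by
          refine (norm_inner_le_norm _ _).trans (mul_le_mul_of_nonneg_left ?_ (norm_nonneg _))
          exact ((n i : H →L[ℂ] H).le_of_opNorm_le (hn i) _).trans
            (mul_le_mul_of_nonneg_left ((x : H →L[ℂ] H).le_opNorm _) hC)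
      _ = C * ‖(x : H →L[ℂ] H)‖ * (‖ξ k‖ * ‖η k‖) := by ring
      _ ≤ _ := by
          refine mul_le_mul_of_nonneg_left ?_ (mul_nonneg hC (norm_nonneg _))
          nlinarith [sq_nonneg (‖ξ k‖ - ‖η k‖), norm_nonneg (ξ k), norm_nonneg (η k)]

theorem eq_of_apply_mul_eq {x y : M.Elem} (h : ∀ z, τ (x * z) = τ (y * z)) : x = y := by
  have h1 : star (x - y) = 0 := τ.faithful _ (by
    rw [star_star, sub_mul, map_sub, h, sub_self])
  rwa [star_eq_zero, sub_eq_zero] at h1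

end Trace

end VonNeumannAlgebra

end

/-! ### The adjoint of a trace-preserving embedding -/

noncomputable section

namespace VonNeumannAlgebra

namespace Trace

variable {H : Type u} [NormedAddCommGroup H] [InnerProductSpace ℂ H] [CompleteSpace H]
  {M : VonNeumannAlgebra H} {τ : Trace M}
  {K : Type u} [NormedAddCommGroup K] [InnerProductSpace ℂ K] [CompleteSpace K]
  {N : VonNeumannAlgebra K} {σ : Trace N} {f : N.Elem →⋆ₐ[ℂ] M.Elem}

theorem Preserves.norm2_map (hf : σ.Preserves τ f) (x : N.Elem) :
    τ.norm2 (f x) = σ.norm2 x := by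
  rw [norm2, norm2, ← StarHomClass.map_star f, ← map_mul f, hf]

/-- An orthogonal projection without completing `N`: take `f y` within `ε²` of the infimum of the
squared distance from `a`. A variation in the direction `x` can then gain at most `ε²`. -/
theorem Preserves.exists_almost_orthogonal (hf : σ.Preserves τ f) (a : M.Elem) {ε : ℝ}
    (hε : 0 < ε) :
    ∃ y : N.Elem, ∀ x, ‖τ (star (a - f y) * f x)‖ ≤ ε * σ.norm2 x := by
  have hbdd : BddBelow (Set.range fun y => τ.norm2 (a - f y) ^ 2) :=
    ⟨0, by rintro _ ⟨y, rfl⟩; exact sq_nonneg _⟩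
  obtain ⟨_, ⟨y, rfl⟩, hy⟩ := Real.lt_sInf_add_pos (Set.range_nonempty
    fun y => τ.norm2 (a - f y) ^ 2) (pow_pos hε 2)
  refine ⟨y, fun x => ?_⟩
  by_cases hx : σ.norm2 x = 0
  · rw [σ.norm2_eq_zero_iff.1 hx]; simp [σ.norm2_zero]
  have hx0 : 0 < σ.norm2 x := lt_of_le_of_ne (σ.norm2_nonneg x) (Ne.symm hx)
  set z := τ (star (a - f y) * f x) with hz
  -- The optimal coefficient: subtracting `c f(x)` lowers the squared distance by exactly `|z|² /
  -- ‖x‖₂²`.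
  set c : ℂ := star z / (σ.norm2 x ^ 2 : ℝ) with hc
  have h1 := csInf_le hbdd ⟨y + c • x, rfl⟩
  have h2 : a - f (y + c • x) = (a - f y) - c • f x := by rw [map_add, map_smul]; abel
  have h3 : τ.norm2 (c • f x) ^ 2 = ‖c‖ ^ 2 * σ.norm2 x ^ 2 := by
    rw [← hf.norm2_map, norm2_sq, norm2_sq, star_smul, smul_mul_smul_comm, map_smul, smul_eq_mul,
      Complex.star_def, ← Complex.normSq_eq_conj_mul_self, Complex.re_ofReal_mul,
      Complex.normSq_eq_norm_sq]
  have h4 : (τ (star (a - f y) * c • f x)).re = ‖z‖ ^ 2 / σ.norm2 x ^ 2 := by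
    rw [mul_smul_comm, map_smul, smul_eq_mul, ← hz, hc, div_mul_eq_mul_div, Complex.star_def,
      ← Complex.normSq_eq_conj_mul_self, ← Complex.ofReal_div, Complex.ofReal_re,
      Complex.normSq_eq_norm_sq]
  have h5 : ‖c‖ = ‖z‖ / σ.norm2 x ^ 2 := by
    rw [hc, norm_div, norm_star, Complex.norm_real, Real.norm_of_nonneg (sq_nonneg _)]
  dsimp only at h1
  rw [h2, norm2_sub_sq, h3, h4, h5] at h1
  have h6 : (‖z‖ / σ.norm2 x ^ 2) ^ 2 * σ.norm2 x ^ 2 = ‖z‖ ^ 2 / σ.norm2 x ^ 2 := by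
    field_simp
  rw [h6] at h1
  have h7 : ‖z‖ ^ 2 / σ.norm2 x ^ 2 ≤ ε ^ 2 := by linarith
  rw [div_le_iff₀ (by positivity), ← mul_pow] at h7
  exact le_of_sq_le_sq h7 (by positivity)

theorem Preserves.exists_selfAdjoint_almost_orthogonal (hf : σ.Preserves τ f) {a : M.Elem}
    (ha : IsSelfAdjoint a) {ε : ℝ} (hε : 0 < ε) :
    ∃ y : N.Elem, IsSelfAdjoint y ∧ ∀ x, ‖τ ((a - f y) * f x)‖ ≤ ε * σ.norm2 x := by
  obtain ⟨y, hy⟩ := hf.exists_almost_orthogonal a hε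
  have hy' : ∀ x, ‖τ ((a - f y) * f x)‖ ≤ ε * σ.norm2 x := fun x => by
    have := hy (star x)
    rwa [← norm_star, ← τ.map_star, star_mul, star_star, ← StarHomClass.map_star f, star_star, τ.mul_comm,
      norm2_star] at this
  refine ⟨(2⁻¹ : ℂ) • (y + star y), ?_, fun x => ?_⟩
  · rw [isSelfAdjoint_iff, star_smul, star_add, star_star, add_comm]
    norm_num
  · have e : (a - f ((2⁻¹ : ℂ) • (y + star y))) * f x
        = (2⁻¹ : ℂ) • ((a - f y) * f x) + (2⁻¹ : ℂ) • (star (a - f y) * f x) := by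
      rw [map_smul, map_add, StarHomClass.map_star, ← smul_add, ← add_mul, star_sub, ha.star_eq,
        ← smul_mul_assoc]
      congr 1
      have : a = (2⁻¹ : ℂ) • (a + a) := by rw [← two_smul ℂ a, smul_smul]; norm_num
      nth_rewrite 1 [this]
      rw [← smul_sub]
      congr 1
      abel
    rw [e, map_add, map_smul, map_smul]
    refine (norm_add_le _ _).trans ?_
    have h2 : ‖(2⁻¹ : ℂ)‖ = 2⁻¹ := by norm_num
    rw [norm_smul, norm_smul, h2]
    linarith [hy x, hy' x]

/-- The projection of `a` should not exceed `‖a‖`. For `p = (y - ‖a‖)₊` one has `y p = p² + ‖a‖ p`,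
whereas `|τ(a f(p))| ≤ ‖a‖ σ(p)`; testing near-orthogonality on `p` leaves `‖p‖₂² ≤ ε ‖p‖₂`. -/
theorem Preserves.norm2_cfc_max_sub_le (hf : σ.Preserves τ f) {a : M.Elem} {y : N.Elem}
    (hysa : IsSelfAdjoint y) {ε : ℝ} (hy : ∀ x, ‖τ ((a - f y) * f x)‖ ≤ ε * σ.norm2 x) :
    σ.norm2 (cfc (fun t : ℝ => max (t - ‖a‖) 0) y) ≤ ε := by
  have hε : 0 ≤ ε := by
    have := (norm_nonneg _).trans (hy 1)
    rwa [norm2_one, mul_one] at this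
  set m : ℝ → ℝ := fun t => max (t - ‖a‖) 0 with hm
  have hm0 : ∀ t, 0 ≤ m t := fun t => le_max_right _ _
  have hmc : Continuous m := by fun_prop
  set p := cfc m y
  set r := cfc (fun t => √(m t)) y
  have hrsa : star r = r := (cfc_predicate _ _ : IsSelfAdjoint r).star_eq
  have hrr : r * r = p := by
    rw [← cfc_mul _ _ y]
    exact cfc_congr fun t _ => Real.mul_self_sqrt (hm0 t)
  have hyp : y * p = star p * p + (‖a‖ : ℂ) • p := by
    have h1 : y * p = cfc (fun t => t * m t) y := by
      rw [cfc_mul (fun t => t) m y, cfc_id' ℝ y]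
    have h2 : (‖a‖ : ℂ) • p = cfc (fun t => ‖a‖ * m t) y := by
      rw [cfc_const_mul ‖a‖ m y]; rfl
    rw [(cfc_predicate _ _ : IsSelfAdjoint p).star_eq, h1, h2, ← cfc_mul m m y, 
      ← cfc_add y (fun t => m t * m t) (fun t => ‖a‖ * m t)]
    refine cfc_congr fun t _ => ?_
    simp only [hm]
    rcases le_total (t - ‖a‖) 0 with h | h
    · rw [max_eq_right h]; ring
    · rw [max_eq_left h]; ring
  clear_value p r
  have h1 : (σ (y * p)).re = σ.norm2 p ^ 2 + ‖a‖ * (σ p).re := by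
    rw [hyp, map_add, map_smul, smul_eq_mul, Complex.add_re, Complex.re_ofReal_mul, norm2_sq]
  have h2 : (σ p).re = σ.norm2 r ^ 2 := by rw [norm2_sq, hrsa, hrr]
  have h3 : ‖τ (a * f p)‖ ≤ ‖a‖ * σ.norm2 r ^ 2 := by
    rw [← hrr, map_mul f, ← mul_assoc]
    refine (τ.norm_apply_mul_le _ _).trans ?_
    rw [sq, ← mul_assoc, ← hf.norm2_map]
    exact mul_le_mul_of_nonneg_right (τ.norm2_mul_le _ _) (τ.norm2_nonneg _)
  have h4 := hy p
  rw [sub_mul, map_sub, ← map_mul f, hf] at h4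
  have h5 := (abs_le.1 ((Complex.abs_re_le_norm _).trans h4)).1
  have h6 := (Complex.re_le_norm _).trans h3
  rw [Complex.sub_re, h1, h2] at h5
  have h7 : σ.norm2 p ^ 2 ≤ ε * σ.norm2 p := by linarith
  rcases (σ.norm2_nonneg p).eq_or_lt with h | h
  · rw [← h]; exact hε
  · rw [sq] at h7; exact le_of_mul_le_mul_right h7 h

theorem Preserves.exists_bounded_almost_orthogonal (hf : σ.Preserves τ f) {a : M.Elem}
    (ha : IsSelfAdjoint a) {ε : ℝ} (hε : 0 < ε) :
    ∃ y : N.Elem, ‖y‖ ≤ ‖a‖ ∧ ∀ x, ‖σ (y * x) - τ (a * f x)‖ ≤ ε * σ.norm2 x := by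
  -- One third of `ε` for near-orthogonality and one for each of the two truncations, at `‖a‖` and
  -- at `-‖a‖`.
  obtain ⟨y, hysa, hy⟩ := hf.exists_selfAdjoint_almost_orthogonal ha (ε := ε / 3) (by positivity)
  have hp := hf.norm2_cfc_max_sub_le hysa hy
  have hq := hf.norm2_cfc_max_sub_le (a := -a) (y := -y) hysa.neg (ε := ε / 3) (fun x => by
    have : (-a - f (-y)) * f x = -((a - f y) * f x) := by rw [map_neg, ← neg_mul]; congr 1; abel
    rw [this, map_neg, norm_neg]; exact hy x)
  rw [norm_neg, ← cfc_comp_neg (fun t : ℝ => max (t - ‖a‖) 0) y] at hq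
  set c := ‖a‖
  have hc : 0 ≤ c := norm_nonneg _
  have e : cfc (fun t : ℝ => max (-c) (min c t)) y = y - (cfc (fun t : ℝ => max (t - c) 0) y
      - cfc (fun t : ℝ => max (-t - c) 0) y) := by
    rw [← cfc_sub _ _ y]
    nth_rewrite 2 [← cfc_id' ℝ y]
    rw [← cfc_sub _ _ y]
    refine cfc_congr fun t _ => ?_
    rcases le_total t c with h1 | h1 <;> rcases le_total (-c) t with h2 | h2
    · rw [min_eq_right h1, max_eq_right h2, max_eq_right (by linarith), max_eq_right (by linarith)]
      ring
    · rw [min_eq_right h1, max_eq_left h2, max_eq_right (by linarith), max_eq_left (by linarith)]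
      ring
    · rw [min_eq_left h1, max_eq_right (by linarith), max_eq_left (by linarith),
        max_eq_right (by linarith)]
      ring
    · rw [min_eq_left h1, max_eq_right (by linarith), max_eq_left (by linarith),
        max_eq_right (by linarith)]
      ring
  refine ⟨cfc (fun t : ℝ => max (-c) (min c t)) y, norm_cfc_le hc fun t _ => ?_, fun x => ?_⟩
  · rw [Real.norm_eq_abs, abs_le]
    exact ⟨le_max_left _ _, max_le (by linarith) (min_le_left _ _)⟩
  · rw [e]
    set p := cfc (fun t : ℝ => max (t - c) 0) y
    set q := cfc (fun t : ℝ => max (-t - c) 0) y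
    have h1 : σ ((y - (p - q)) * x) - τ (a * f x)
        = -(τ ((a - f y) * f x) + σ ((p - q) * x)) := by
      rw [sub_mul, map_sub, sub_mul a, map_sub, ← map_mul f, hf]; ring
    rw [h1, norm_neg]
    have h2 := σ.norm_apply_mul_le (p - q) x
    have h3 := mul_le_mul_of_nonneg_right ((σ.norm2_sub p q).trans (add_le_add hp hq))
      (σ.norm2_nonneg x)
    have h4 := norm_add_le (τ ((a - f y) * f x)) (σ ((p - q) * x))
    linarith [hy x]

/-- The approximate projections of a self-adjoint element are uniformly bounded in operator norm, so
their weak limit lies in `N` and not merely in its `L²`-completion. The general case follows by real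
and imaginary parts. -/
theorem Preserves.exists_adjoint (hf : σ.Preserves τ f) (a : M.Elem) :
    ∃ y : N.Elem, ∀ x, σ (y * x) = τ (a * f x) := by
  have hsa : ∀ b : M.Elem, IsSelfAdjoint b → ∃ y : N.Elem, ∀ x, σ (y * x) = τ (b * f x) := by
    intro b hb
    choose y hy1 hy2 using fun k : ℕ =>
      hf.exists_bounded_almost_orthogonal hb (Nat.one_div_pos_of_nat (α := ℝ) (n := k))
    obtain ⟨m, hm⟩ := σ.exists_tendsto_apply_mul (hyperfilter ℕ) y hy1
    refine ⟨m, fun x => tendsto_nhds_unique (hm x) ?_⟩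
    refine Tendsto.mono_left ?_ Nat.hyperfilter_le_atTop
    rw [tendsto_iff_norm_sub_tendsto_zero]
    refine squeeze_zero (fun _ => norm_nonneg _) (fun k => hy2 k x) ?_
    simpa using tendsto_one_div_add_atTop_nhds_zero_nat.mul_const (σ.norm2 x)
  obtain ⟨y, hy⟩ := hsa (realPart a) (realPart a).2
  obtain ⟨z, hz⟩ := hsa (imaginaryPart a) (imaginaryPart a).2
  refine ⟨y + Complex.I • z, fun x => ?_⟩
  conv_rhs => rw [← realPart_add_I_smul_imaginaryPart a]
  simp only [add_mul, smul_mul_assoc, map_add, map_smul, hy, hz]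

/-- The adjoint `M → N` of an embedding `f : N → M` for the traces. For an inclusion this is the
trace-preserving conditional expectation. -/
def Preserves.adj (hf : σ.Preserves τ f) : M.Elem →ₗ[ℂ] N.Elem where
  toFun a := (hf.exists_adjoint a).choose
  map_add' a b := σ.eq_of_apply_mul_eq fun x => by
    rw [add_mul, map_add, (hf.exists_adjoint _).choose_spec, (hf.exists_adjoint _).choose_spec,
      (hf.exists_adjoint _).choose_spec, add_mul, map_add]
  map_smul' c a := σ.eq_of_apply_mul_eq fun x => by
    rw [RingHom.id_apply, smul_mul_assoc, map_smul, (hf.exists_adjoint _).choose_spec,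
      (hf.exists_adjoint _).choose_spec, smul_mul_assoc, map_smul]

theorem Preserves.apply_adj_mul (hf : σ.Preserves τ f) (a : M.Elem) (x : N.Elem) :
    σ (hf.adj a * x) = τ (a * f x) :=
  (hf.exists_adjoint a).choose_spec x

theorem Preserves.adj_mul_left (hf : σ.Preserves τ f) (a : M.Elem) (x : N.Elem) :
    hf.adj (f x * a) = x * hf.adj a :=
  σ.eq_of_apply_mul_eq fun z => by
    rw [hf.apply_adj_mul, mul_assoc, τ.mul_comm, mul_assoc, ← map_mul f, mul_assoc,
      σ.mul_comm x, mul_assoc, hf.apply_adj_mul]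

theorem Preserves.adj_one (hf : σ.Preserves τ f) : hf.adj 1 = 1 :=
  σ.eq_of_apply_mul_eq fun z => by
    rw [hf.apply_adj_mul, one_mul, one_mul, hf]

theorem Preserves.adj_star (hf : σ.Preserves τ f) (a : M.Elem) :
    hf.adj (star a) = star (hf.adj a) :=
  σ.eq_of_apply_mul_eq fun z => by
    rw [hf.apply_adj_mul, ← star_star z, ← star_mul, σ.map_star, σ.mul_comm, hf.apply_adj_mul,
      ← τ.map_star, star_mul, star_star, StarHomClass.map_star f, star_star, τ.mul_comm]

/-- Complete positivity in the form used below: tested against `x`, the matrix gives `τ(z* z)` with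
`z = ∑ b j f(x j)`, so it is a Gram matrix by `exists_gram_of_nonneg`. -/
theorem Preserves.exists_adj_gram (hf : σ.Preserves τ f) {ι : Type*} [Fintype ι]
    (b : ι → M.Elem) : ∃ d : ι → ι → N.Elem, ∀ i j,
      hf.adj (star (b i) * b j) = ∑ k, star (d k i) * d k j := by
  refine exists_gram_of_nonneg σ.toLinearMap (fun x => (σ.star_mul_self_pos x).1)
    (fun x hx => ?_) _ (fun i j => ?_) fun x => ?_
  · exact σ.faithful x (Complex.ext hx (σ.star_mul_self_pos x).2)
  · rw [← hf.adj_star, star_mul, star_star]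
  · refine (τ.star_mul_self_pos (∑ j, b j * f (x j))).1.trans_eq (congrArg Complex.re ?_)
    rw [star_sum, Finset.sum_mul, map_sum]
    refine Finset.sum_congr rfl fun i _ => ?_
    rw [Finset.mul_sum, map_sum]
    refine Finset.sum_congr rfl fun j _ => ?_
    have h1 : σ (star (x i) * hf.adj (star (b i) * b j) * x j)
        = σ (hf.adj (star (b i) * b j) * (x j * star (x i))) := by
      rw [mul_assoc, σ.mul_comm, mul_assoc]
    rw [h1, hf.apply_adj_mul, map_mul f, StarHomClass.map_star f, star_mul, mul_assoc, τ.mul_comm]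
    simp only [mul_assoc]

end Trace

end VonNeumannAlgebra

end

/-! ### Covariances and the algebraic Fock space -/

noncomputable section

namespace VonNeumannAlgebra

namespace Trace

variable {H : Type u} [NormedAddCommGroup H] [InnerProductSpace ℂ H] [CompleteSpace H]
  {M : VonNeumannAlgebra H}

/-- A pair of unital completely positive maps of `M`, adjoint to each other for the trace. -/
structure Covariance (τ : Trace M) where
  η : Bool → M.Elem →ₗ[ℂ] M.Elem
  map_star : ∀ e a, η e (star a) = star (η e a)
  map_one : ∀ e, η e 1 = 1
  dual : ∀ e a b, τ (η e a * b) = τ (a * η (!e) b)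
  gram : ∀ e {ι : Type u} [Fintype ι] (b : ι → M.Elem), ∃ d : ι → ι → M.Elem,
    ∀ i j, η e (star (b i) * b j) = ∑ k, star (d k i) * d k j

/-- Words `a₀ e₁ a₁ … eₙ aₙ` with letters `eᵢ = ±` and coefficients `aᵢ` in `M`, recorded as the list
of the `(aᵢ₋₁, eᵢ)` together with `aₙ`. -/
abbrev Word (M : VonNeumannAlgebra H) : Type u := List (M.Elem × Bool) × M.Elem

namespace Covariance

variable {τ : Trace M} (C : Covariance τ)

/-- The `M`-valued inner product of two words, with a middle coefficient. -/
def kernel : List (M.Elem × Bool) → List (M.Elem × Bool) → M.Elem → M.Elem →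
    (M.Elem →ₗ[ℂ] M.Elem)
  | [], [], a, b => LinearMap.mulRight ℂ b ∘ₗ LinearMap.mulLeft ℂ (star a)
  | p :: l, q :: l', a, b =>
    if p.2 = q.2 then kernel l l' a b ∘ₗ C.η p.2 ∘ₗ LinearMap.mulRight ℂ q.1 ∘ₗ
      LinearMap.mulLeft ℂ (star p.1) else 0
  | [], _ :: _, _, _ => 0
  | _ :: _, [], _, _ => 0

@[simp] theorem kernel_nil_nil (a b z : M.Elem) : C.kernel [] [] a b z = star a * z * b := rfl

@[simp] theorem kernel_nil_cons (q l') (a b : M.Elem) : C.kernel [] (q :: l') a b = 0 := by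
  simp [kernel]

@[simp] theorem kernel_cons_nil (p l) (a b : M.Elem) : C.kernel (p :: l) [] a b = 0 := by
  simp [kernel]

theorem kernel_cons_cons (p q l l') (a b z : M.Elem) : C.kernel (p :: l) (q :: l') a b z =
    if p.2 = q.2 then C.kernel l l' a b (C.η p.2 (star p.1 * z * q.1)) else 0 := by
  rw [kernel]
  split_ifs <;> rfl

theorem star_kernel (l l') (a b z : M.Elem) :
    star (C.kernel l l' a b z) = C.kernel l' l b a (star z) := by
  induction l generalizing l' z with
  | nil => cases l' <;> simp [mul_assoc]
  | cons p l ih =>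
    cases l' with
    | nil => simp
    | cons q l' =>
      rw [kernel_cons_cons, kernel_cons_cons]
      by_cases h : p.2 = q.2
      · rw [if_pos h, if_pos h.symm, ih, ← C.map_star, h]
        simp [mul_assoc]
      · rw [if_neg h, if_neg (Ne.symm h), star_zero]

/-- The contribution of a word without letters. -/
def constPart (l : List (M.Elem × Bool)) (c a : M.Elem) : M.Elem :=
  match l with
  | [] => c * a
  | _ :: _ => 0

/-- The first coefficient of a word whose first letter is `e`. -/
def headPart (e : Bool) (l : List (M.Elem × Bool)) (c : M.Elem) : M.Elem :=
  match l with
  | [] => 0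
  | p :: _ => if p.2 = e then c * p.1 else 0

/-- Sorts by first letter: the summand for `e` is nonzero only if both words begin with `e`. This
isolates one application of `η e`, to which complete positivity applies. -/
theorem kernel_eq_constPart_add (l l') (a b c d : M.Elem) :
    C.kernel l l' a b (star c * d) = star (constPart l c a) * constPart l' d b +
      ∑ e, C.kernel l.tail l'.tail a b (C.η e (star (headPart e l c) * headPart e l' d)) := by
  rcases l with - | ⟨⟨p, e⟩, l⟩ <;> rcases l' with - | ⟨⟨q, e'⟩, l'⟩
  · simp [constPart, headPart, mul_assoc]
  · simp [constPart, headPart]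
  · simp [constPart, headPart]
  · rw [kernel_cons_cons]
    cases e <;> cases e' <;> simp [constPart, headPart, mul_assoc]

/-- Induction on the length. By `gram`, one application of `η e` turns the middle coefficients into
a sum of Gram matrices `star (d k i) * d k j`, and each `k` contributes a form of the same shape in
the tails. The middle coefficients `c` are there for the sake of this induction. -/
theorem re_sum_kernel_nonneg (n : ℕ) {ι : Type u} [Fintype ι] (l : ι → List (M.Elem × Bool))
    (a c : ι → M.Elem) (hl : ∀ i, (l i).length ≤ n) :
    0 ≤ (∑ i, ∑ j, τ (C.kernel (l i) (l j) (a i) (a j) (star (c i) * c j))).re := by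
  have hsq : ∀ x : ι → M.Elem, 0 ≤ (∑ i, ∑ j, τ (star (x i) * x j)).re := fun x => by
    refine (τ.star_mul_self_pos (∑ i, x i)).1.trans_eq (congrArg Complex.re ?_)
    simp only [star_sum, Finset.sum_mul, Finset.mul_sum, map_sum]
    exact Finset.sum_comm
  induction n generalizing l c with
  | zero =>
    have h0 : ∀ i, l i = [] := fun i => List.length_eq_zero_iff.1 (Nat.le_zero.1 (hl i))
    refine (hsq fun i => c i * a i).trans_eq (congrArg Complex.re ?_)
    refine Finset.sum_congr rfl fun i _ => Finset.sum_congr rfl fun j _ => ?_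
    rw [h0, h0, kernel_nil_nil, star_mul]
    simp only [mul_assoc]
  | succ n ih =>
    have hrest : ∀ i, (l i).tail.length ≤ n := fun i => by
      rw [List.length_tail]; have := hl i; omega
    choose d hd using fun e => C.gram e fun i => headPart e (l i) (c i)
    have e1 : ∑ i, ∑ j, τ (C.kernel (l i) (l j) (a i) (a j) (star (c i) * c j))
        = ∑ i, ∑ j, τ (star (constPart (l i) (c i) (a i)) * constPart (l j) (c j) (a j)) +
          ∑ e, ∑ k, ∑ i, ∑ j, τ (C.kernel (l i).tail (l j).tail (a i) (a j)
            (star (d e k i) * d e k j)) := by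
      have e2 : ∀ i j, τ (C.kernel (l i) (l j) (a i) (a j) (star (c i) * c j))
          = τ (star (constPart (l i) (c i) (a i)) * constPart (l j) (c j) (a j)) +
            ∑ e, ∑ k, τ (C.kernel (l i).tail (l j).tail (a i) (a j)
              (star (d e k i) * d e k j)) := fun i j => by
        rw [kernel_eq_constPart_add, map_add, map_sum]
        simp only [hd, map_sum]
      simp only [e2, Finset.sum_add_distrib]
      congr 1
      rw [Finset.sum_congr rfl fun i _ => Finset.sum_comm, Finset.sum_comm]
      refine Finset.sum_congr rfl fun e _ => ?_
      rw [Finset.sum_congr rfl fun i _ => Finset.sum_comm, Finset.sum_comm]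
    rw [e1, Complex.add_re]
    refine add_nonneg (hsq _) ?_
    rw [Complex.re_sum]
    refine Finset.sum_nonneg fun e _ => ?_
    rw [Complex.re_sum]
    exact Finset.sum_nonneg fun k _ => ih _ _ hrest

/-- The algebraic Fock space: formal combinations of words. -/
def PreFock (_C : Covariance τ) : Type u := Word M →₀ ℂ

instance : AddCommGroup C.PreFock := inferInstanceAs (AddCommGroup (Word M →₀ ℂ))
instance : Module ℂ C.PreFock := inferInstanceAs (Module ℂ (Word M →₀ ℂ))

/-- The basis vector given by a word. -/
def vec (x : Word M) : C.PreFock := (Finsupp.single x 1 : Word M →₀ ℂ)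

/-- Linear extension of a map on words. -/
def lift {E : Type*} [AddCommGroup E] [Module ℂ E] (g : Word M → E) : C.PreFock →ₗ[ℂ] E :=
  Finsupp.linearCombination ℂ g

@[simp] theorem lift_vec {E : Type*} [AddCommGroup E] [Module ℂ E] (g : Word M → E)
    (x : Word M) : C.lift g (C.vec x) = g x :=
  (Finsupp.linearCombination_single ℂ (1 : ℂ) x).trans (one_smul ℂ (g x))

@[elab_as_elim]
theorem induction_vec {p : C.PreFock → Prop} (v : C.PreFock) (h0 : p 0)
    (hadd : ∀ v w, p v → p w → p (v + w)) (hvec : ∀ (c : ℂ) x, p (c • C.vec x)) : p v := by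
  refine Finsupp.induction_linear (motive := p) v h0 hadd fun x c => ?_
  have : (Finsupp.single x c : Word M →₀ ℂ) = c • (Finsupp.single x 1 : Word M →₀ ℂ) := by simp
  rw [this]
  exact hvec c x

theorem hom_ext {E : Type*} [AddCommGroup E] [Module ℂ E] {f g : C.PreFock →ₗ[ℂ] E}
    (h : ∀ x, f (C.vec x) = g (C.vec x)) : f = g :=
  LinearMap.ext fun v => by
    refine C.induction_vec v ?_ (fun v w hv hw => ?_) fun c x => ?_
    · rw [map_zero, map_zero]
    · rw [map_add, map_add, hv, hw]
    · rw [map_smul, map_smul, h]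

/-- The value of the scalar inner product on words. -/
def gramValue (x y : Word M) : ℂ := τ (C.kernel x.1 y.1 x.2 y.2 1)

theorem conj_gramValue (x y : Word M) : starRingEnd ℂ (C.gramValue x y) = C.gramValue y x := by
  rw [gramValue, gramValue, ← Complex.star_def, ← τ.map_star, star_kernel, star_one]

/-- The scalar inner product. -/
def form (v w : C.PreFock) : ℂ :=
  C.lift (fun y => starRingEnd ℂ (C.lift (fun x => C.gramValue y x) v)) w

theorem form_vec_vec (x y : Word M) : C.form (C.vec x) (C.vec y) = C.gramValue x y := by
  simp [form, conj_gramValue]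

theorem form_add_right (u v w) : C.form u (v + w) = C.form u v + C.form u w := map_add _ _ _

theorem form_smul_right (c : ℂ) (v w) : C.form v (c • w) = c * C.form v w := map_smul _ _ _

theorem form_add_left (u v w) : C.form (u + v) w = C.form u w + C.form v w := by
  rw [form, form, form, ← LinearMap.add_apply]
  congr 1
  exact C.hom_ext fun x => by simp

theorem form_smul_left (c : ℂ) (v w) : C.form (c • v) w = starRingEnd ℂ c * C.form v w := by
  rw [form, form, ← smul_eq_mul, ← LinearMap.smul_apply]
  congr 1
  exact C.hom_ext fun x => by simp

theorem form_conj (v w) : starRingEnd ℂ (C.form w v) = C.form v w := by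
  refine C.induction_vec v ?_ (fun v v' h h' => ?_) fun c x => ?_
  · have h1 : C.form w 0 = 0 := map_zero _
    have h2 : C.form 0 w = 0 := by simpa using C.form_smul_left 0 0 w
    rw [h1, h2, map_zero]
  · rw [form_add_right, form_add_left, map_add, h, h']
  · rw [form_smul_right, form_smul_left, map_mul]
    congr 1
    refine C.induction_vec w ?_ (fun v v' h h' => ?_) fun c y => ?_
    · have h1 : C.form (C.vec x) 0 = 0 := map_zero _
      have h2 : C.form 0 (C.vec x) = 0 := by simpa using C.form_smul_left 0 0 (C.vec x)
      rw [h1, h2, map_zero]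
    · rw [form_add_right, form_add_left, map_add, h, h']
    · rw [form_smul_right, form_smul_left, map_mul, form_vec_vec, form_vec_vec, conj_gramValue,
        Complex.conj_conj]

theorem re_form_self_nonneg (v) : 0 ≤ (C.form v v).re := by
  let s : Finset (Word M) := Finsupp.support (show Word M →₀ ℂ from v)
  let c : Word M → ℂ := (show Word M →₀ ℂ from v)
  have hv : ∀ {E : Type} [AddCommGroup E] [Module ℂ E] (g : Word M → E),
      C.lift g v = ∑ x : s, c x.1 • g x.1 := by
    intro E _ _ g
    refine (Finsupp.linearCombination_apply ℂ _).trans ?_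
    exact (Finset.sum_coe_sort s fun x => c x • g x).symm
  -- The scalar coefficients of `v` enter as the middle coefficients `c x • 1`.
  have key := C.re_sum_kernel_nonneg (s.sup fun x => x.1.length) (fun x : s => x.1.1)
    (fun x => x.1.2) (fun x => c x.1 • 1) (fun x => Finset.le_sup (f := fun x => x.1.length) x.2)
  refine key.trans_eq (congrArg Complex.re (Eq.symm ?_))
  rw [form, hv, Finset.sum_comm]
  refine Finset.sum_congr rfl fun y _ => ?_
  rw [hv, map_sum, smul_eq_mul, Finset.mul_sum]
  refine Finset.sum_congr rfl fun x _ => ?_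
  rw [smul_eq_mul, map_mul, conj_gramValue, gramValue, star_smul, star_one, smul_mul_smul_comm,
    one_mul, map_smul, map_smul, smul_eq_mul, Complex.star_def]
  ring

/-- The pre-inner product of the algebraic Fock space. -/
@[reducible]
def preInnerCore : PreInnerProductSpace.Core ℂ C.PreFock where
  inner := C.form
  conj_inner_symm v w := C.form_conj v w
  re_inner_nonneg v := C.re_form_self_nonneg v
  add_left := C.form_add_left
  smul_left v w c := C.form_smul_left c v w

instance : SeminormedAddCommGroup C.PreFock :=
  InnerProductSpace.Core.toSeminormedAddCommGroup (c := C.preInnerCore)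

instance : InnerProductSpace ℂ C.PreFock := InnerProductSpace.ofCore C.preInnerCore

theorem inner_vec_vec (x y : Word M) :
    inner ℂ (C.vec x) (C.vec y) = τ (C.kernel x.1 y.1 x.2 y.2 1) := C.form_vec_vec x y

/-- Distinct words are linearly independent symbols, so many relations hold only modulo null
vectors. They are stated inside inner products and checked on words. -/
theorem inner_ext {S T : C.PreFock →ₗ[ℂ] C.PreFock} {S' T' : C.PreFock →ₗ[ℂ] C.PreFock}
    (h : ∀ x y, inner ℂ (S (C.vec x)) (T (C.vec y)) = inner ℂ (S' (C.vec x)) (T' (C.vec y)))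
    (v w : C.PreFock) : inner ℂ (S v) (T w) = inner ℂ (S' v) (T' w) := by
  refine C.induction_vec v ?_ (fun v v' h h' => ?_) fun c x => ?_
  · simp
  · simp only [map_add, inner_add_left, h, h']
  · simp only [map_smul, inner_smul_left]
    congr 1
    refine C.induction_vec w ?_ (fun v v' h h' => ?_) fun c y => ?_
    · simp
    · simp only [map_add, inner_add_right, h, h']
    · simp only [map_smul, inner_smul_right, h]

end Covariance

end Trace

end VonNeumannAlgebra

end

/-! ### Left and right operators on the algebraic Fock space -/

noncomputable section

/-- Yields the bound `norm_leftMul_le` from algebraic relations alone: `‖m‖² ‖v‖² = ‖m v‖² + ‖c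
v‖²`. -/
theorem exists_norm_sq_smul_one_eq {A : Type*} [CStarAlgebra A] (m : A) :
    ∃ c : A, ((‖m‖ ^ 2 : ℝ) : ℂ) • (1 : A) = star m * m + star c * c := by
  let _ := CStarAlgebra.spectralOrder A
  have _ := CStarAlgebra.spectralOrderedRing A
  obtain ⟨c, hc⟩ := CStarAlgebra.nonneg_iff_eq_star_mul_self.1
    (sub_nonneg.2 (CStarAlgebra.star_mul_le_algebraMap_norm_sq (a := m)))
  refine ⟨c, ?_⟩
  rw [← hc, add_sub_cancel, Algebra.algebraMap_eq_smul_one]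
  rfl

namespace VonNeumannAlgebra

namespace Trace

namespace Covariance

variable {H : Type u} [NormedAddCommGroup H] [InnerProductSpace ℂ H] [CompleteSpace H]
  {M : VonNeumannAlgebra H} {τ : Trace M} (C : Covariance τ)

/-- Left multiplication of a word by a coefficient. -/
def mulWord (m : M.Elem) : Word M → Word M
  | ([], a) => ([], m * a)
  | (p :: l, a) => ((m * p.1, p.2) :: l, a)

@[simp] theorem mulWord_nil (m a : M.Elem) : mulWord m ([], a) = ([], m * a) := rfl

@[simp] theorem mulWord_cons (m a : M.Elem) (p l) :
    mulWord m (p :: l, a) = ((m * p.1, p.2) :: l, a) := rfl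

/-- Left multiplication by a coefficient on the algebraic Fock space. -/
def leftMul (m : M.Elem) : C.PreFock →ₗ[ℂ] C.PreFock := C.lift fun x => C.vec (mulWord m x)

/-- Prepending a coefficient and a letter. -/
def cons (p : M.Elem × Bool) : C.PreFock →ₗ[ℂ] C.PreFock :=
  C.lift fun x => C.vec (p :: x.1, x.2)

/-- The left annihilation operator on words. -/
def annihWord (e : Bool) : Word M → C.PreFock
  | ([], _) => 0
  | (p :: l, a) => if p.2 = e then C.vec (mulWord (C.η e p.1) (l, a)) else 0

/-- The left annihilation operator. -/
def annih (e : Bool) : C.PreFock →ₗ[ℂ] C.PreFock := C.lift (C.annihWord e)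

/-- Right multiplication by a coefficient. -/
def rightMul (m : M.Elem) : C.PreFock →ₗ[ℂ] C.PreFock := C.lift fun x => C.vec (x.1, x.2 * m)

/-- The right creation operator. -/
def rightCreate (e : Bool) : C.PreFock →ₗ[ℂ] C.PreFock :=
  C.lift fun x => C.vec (x.1 ++ [(x.2, e)], 1)

/-- The right annihilation operator on words. -/
def rightAnnihWord (e : Bool) : List (M.Elem × Bool) → M.Elem → C.PreFock
  | [], _ => 0
  | [p], a => if p.2 = e then C.vec ([], p.1 * C.η (!e) a) else 0
  | p :: q :: l, a => C.cons p (rightAnnihWord e (q :: l) a)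

/-- The right annihilation operator. -/
def rightAnnih (e : Bool) : C.PreFock →ₗ[ℂ] C.PreFock :=
  C.lift fun x => C.rightAnnihWord e x.1 x.2

/-- The circular operator `ℓ(e) + ℓ(ē)*`. -/
def circ (e : Bool) : C.PreFock →ₗ[ℂ] C.PreFock := C.cons (1, e) + C.annih (!e)

/-- The right circular operator. -/
def rightCirc (e : Bool) : C.PreFock →ₗ[ℂ] C.PreFock := C.rightCreate e + C.rightAnnih (!e)

/-- The vacuum vector. -/
def vacuum : C.PreFock := C.vec ([], 1)

@[simp] theorem leftMul_vec (m : M.Elem) (x : Word M) :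
    C.leftMul m (C.vec x) = C.vec (mulWord m x) := C.lift_vec _ _

@[simp] theorem cons_vec (p) (x : Word M) : C.cons p (C.vec x) = C.vec (p :: x.1, x.2) :=
  C.lift_vec _ _

@[simp] theorem annih_vec_nil (e) (a : M.Elem) : C.annih e (C.vec ([], a)) = 0 := C.lift_vec _ _

theorem annih_vec_cons (e p l) (a : M.Elem) : C.annih e (C.vec (p :: l, a)) =
    if p.2 = e then C.leftMul (C.η e p.1) (C.vec (l, a)) else 0 := by
  rw [leftMul_vec]; exact C.lift_vec _ _

@[simp] theorem rightMul_vec (m : M.Elem) (x : Word M) :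
    C.rightMul m (C.vec x) = C.vec (x.1, x.2 * m) := C.lift_vec _ _

@[simp] theorem rightCreate_vec (e) (x : Word M) :
    C.rightCreate e (C.vec x) = C.vec (x.1 ++ [(x.2, e)], 1) := C.lift_vec _ _

@[simp] theorem rightAnnih_vec_nil (e) (a : M.Elem) : C.rightAnnih e (C.vec ([], a)) = 0 :=
  C.lift_vec _ _

@[simp] theorem rightAnnih_vec_singleton (e p) (a : M.Elem) :
    C.rightAnnih e (C.vec ([p], a)) = if p.2 = e then C.vec ([], p.1 * C.η (!e) a) else 0 :=
  C.lift_vec _ _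

theorem rightAnnih_vec_cons_cons (e p q l) (a : M.Elem) :
    C.rightAnnih e (C.vec (p :: q :: l, a)) = C.cons p (C.rightAnnih e (C.vec (q :: l, a))) := by
  simp only [rightAnnih, lift_vec, rightAnnihWord]

theorem leftMul_cons (m : M.Elem) (p v) :
    C.leftMul m (C.cons p v) = C.cons (m * p.1, p.2) v := by
  rw [← LinearMap.comp_apply]
  congr 1
  exact C.hom_ext fun x => by simp

theorem annih_cons (e p v) :
    C.annih e (C.cons p v) = if p.2 = e then C.leftMul (C.η e p.1) v else 0 := by
  have : C.annih e ∘ₗ C.cons p = if p.2 = e then C.leftMul (C.η e p.1) else 0 :=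
    C.hom_ext fun x => by
      rw [LinearMap.comp_apply, cons_vec, annih_vec_cons]
      split_ifs <;> rfl
  rw [← LinearMap.comp_apply, this]
  split_ifs <;> rfl

theorem leftMul_leftMul (m m' : M.Elem) (v) :
    C.leftMul m (C.leftMul m' v) = C.leftMul (m * m') v := by
  rw [← LinearMap.comp_apply]
  congr 1
  refine C.hom_ext fun ⟨l, a⟩ => ?_
  cases l <;> simp [mul_assoc]

theorem leftMul_one (v) : C.leftMul 1 v = v := by
  have : C.leftMul 1 = LinearMap.id := C.hom_ext fun ⟨l, a⟩ => by cases l <;> simp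
  rw [this, LinearMap.id_apply]

theorem commute_leftMul_rightMul (m m' : M.Elem) : Commute (C.leftMul m) (C.rightMul m') := by
  refine C.hom_ext fun ⟨l, a⟩ => ?_
  cases l <;> simp [mul_assoc]

theorem commute_leftMul_rightCreate (m : M.Elem) (e) :
    Commute (C.leftMul m) (C.rightCreate e) := by
  refine C.hom_ext fun ⟨l, a⟩ => ?_
  cases l <;> simp

theorem commute_leftMul_rightAnnih (m : M.Elem) (e) :
    Commute (C.leftMul m) (C.rightAnnih e) := by
  refine C.hom_ext fun ⟨l, a⟩ => ?_
  rcases l with - | ⟨p, - | ⟨q, l⟩⟩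
  · simp
  · simp only [Module.End.mul_apply, rightAnnih_vec_singleton, leftMul_vec, mulWord_cons]
    split_ifs <;> simp [mul_assoc]
  · simp only [Module.End.mul_apply, rightAnnih_vec_cons_cons, leftMul_vec, mulWord_cons,
      leftMul_cons]

theorem commute_leftMul_rightCirc (m : M.Elem) (e) : Commute (C.leftMul m) (C.rightCirc e) :=
  (C.commute_leftMul_rightCreate m e).add_right (C.commute_leftMul_rightAnnih m _)

theorem commute_circ_rightMul (e) (m : M.Elem) : Commute (C.circ e) (C.rightMul m) := by
  refine Commute.add_left ?_ ?_
  · exact C.hom_ext fun ⟨l, a⟩ => by simp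
  · refine C.hom_ext fun ⟨l, a⟩ => ?_
    rcases l with - | ⟨p, l⟩
    · simp
    · simp only [Module.End.mul_apply, rightMul_vec, annih_vec_cons]
      split_ifs
      · rw [← rightMul_vec C m (l, a)]
        exact congrArg (fun T : C.PreFock →ₗ[ℂ] C.PreFock => T (C.vec (l, a)))
          (C.commute_leftMul_rightMul _ m)
      · simp

/-- The two operators act at opposite ends of a word and can interfere only when there are no
letters. There, for `e' = !e`, adding a letter on one side and removing it from the other gives `η
(!e) a` in either order. -/
theorem commute_circ_rightCirc (e e') : Commute (C.circ e) (C.rightCirc e') := by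
  refine C.hom_ext fun ⟨l, a⟩ => ?_
  have hcomm : ∀ (m : M.Elem) v, C.leftMul m (C.rightCirc e' v) = C.rightCirc e' (C.leftMul m v) :=
    fun m v => congrArg (fun T : C.PreFock →ₗ[ℂ] C.PreFock => T v)
      (C.commute_leftMul_rightCirc m e').eq
  rcases l with - | ⟨p, l⟩
  · simp only [Module.End.mul_apply, circ, rightCirc, LinearMap.add_apply, map_add,
      rightCreate_vec, rightAnnih_vec_nil, map_zero, cons_vec, annih_vec_nil, List.nil_append,
      annih_vec_cons, rightAnnih_vec_singleton, List.cons_append]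
    cases e <;> cases e' <;> simp
  · have h1 : C.rightCirc e' (C.cons (1, e) (C.vec (p :: l, a)))
        = C.cons (1, e) (C.rightCirc e' (C.vec (p :: l, a))) := by
      simp only [rightCirc, LinearMap.add_apply, map_add, cons_vec, rightCreate_vec,
        rightAnnih_vec_cons_cons, List.cons_append]
    have h2 : C.annih (!e) (C.rightCirc e' (C.vec (p :: l, a)))
        = C.rightCirc e' (C.annih (!e) (C.vec (p :: l, a))) := by
      rw [annih_vec_cons]
      have h3 : C.rightCirc e' (if p.2 = !e then C.leftMul (C.η (!e) p.1) (C.vec (l, a)) else 0)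
          = if p.2 = !e then C.leftMul (C.η (!e) p.1) (C.rightCirc e' (C.vec (l, a))) else 0 := by
        split_ifs
        · rw [hcomm]
        · rw [map_zero]
      rw [h3, rightCirc, LinearMap.add_apply, LinearMap.add_apply, map_add]
      rcases l with - | ⟨q, l⟩
      · simp only [rightCreate_vec, rightAnnih_vec_singleton, rightAnnih_vec_nil, add_zero,
          List.cons_append, annih_vec_cons]
        split_ifs <;> simp
      · rw [rightAnnih_vec_cons_cons, annih_cons, rightCreate_vec, rightCreate_vec,
          List.cons_append, annih_vec_cons]
        split_ifs
        · rw [map_add]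
        · rw [add_zero]
    simp only [Module.End.mul_apply, circ, LinearMap.add_apply, map_add, h1, h2]

theorem inner_vec_leftMul_vec (z : M.Elem) (x y : Word M) :
    inner ℂ (C.vec x) (C.leftMul z (C.vec y)) = τ (C.kernel x.1 y.1 x.2 y.2 z) := by
  obtain ⟨l, a⟩ := x
  obtain ⟨l', b⟩ := y
  rw [leftMul_vec, inner_vec_vec]
  cases l <;> cases l' <;> simp [kernel_cons_cons, mul_assoc]

theorem inner_leftMul_left (m : M.Elem) (v w : C.PreFock) :
    inner ℂ (C.leftMul m v) w = inner ℂ v (C.leftMul (star m) w) := by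
  refine C.inner_ext (T := LinearMap.id) (S' := LinearMap.id) (fun x y => ?_) v w
  simp only [LinearMap.id_apply, inner_vec_leftMul_vec]
  obtain ⟨l, a⟩ := x
  obtain ⟨l', b⟩ := y
  rw [leftMul_vec, inner_vec_vec]
  cases l <;> cases l' <;> simp [kernel_cons_cons, mul_assoc]

/-- Fails outside the inner product: words are not additive in their coefficients. -/
theorem inner_leftMul_add (m m' : M.Elem) (v w : C.PreFock) :
    inner ℂ v (C.leftMul (m + m') w) = inner ℂ v (C.leftMul m w + C.leftMul m' w) := by
  refine C.inner_ext (S := LinearMap.id) (S' := LinearMap.id) (T' := C.leftMul m + C.leftMul m')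
    (fun x y => ?_) v w
  simp only [LinearMap.id_apply, LinearMap.add_apply, inner_add_right, inner_vec_leftMul_vec,
    map_add]

theorem inner_leftMul_smul (c : ℂ) (m : M.Elem) (v w : C.PreFock) :
    inner ℂ v (C.leftMul (c • m) w) = inner ℂ v (c • C.leftMul m w) := by
  refine C.inner_ext (S := LinearMap.id) (S' := LinearMap.id) (T' := c • C.leftMul m)
    (fun x y => ?_) v w
  simp only [LinearMap.id_apply, LinearMap.smul_apply, inner_smul_right, inner_vec_leftMul_vec,
    map_smul, smul_eq_mul]

theorem inner_cons_one (e) (v w : C.PreFock) :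
    inner ℂ (C.cons (1, e) v) w = inner ℂ v (C.annih e w) := by
  refine C.inner_ext (T := LinearMap.id) (S' := LinearMap.id) (fun x y => ?_) v w
  obtain ⟨l', b⟩ := y
  cases l' with
  | nil => simp [inner_vec_vec]
  | cons q l' =>
    simp only [LinearMap.id_apply, cons_vec, annih_vec_cons, inner_vec_vec, kernel_cons_cons,
      star_one, one_mul]
    by_cases h : e = q.2
    · rw [if_pos h, if_pos h.symm, inner_vec_leftMul_vec]
    · rw [if_neg h, if_neg (Ne.symm h), inner_zero_right, map_zero]

theorem inner_circ_left (e) (v w : C.PreFock) :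
    inner ℂ (C.circ e v) w = inner ℂ v (C.circ (!e) w) := by
  rw [circ, circ, LinearMap.add_apply, LinearMap.add_apply, inner_add_left, inner_add_right,
    inner_cons_one, add_comm, Bool.not_not]
  congr 1
  rw [← inner_conj_symm, ← inner_cons_one, inner_conj_symm]

theorem inner_vacuum_cons (p v) : inner ℂ C.vacuum (C.cons p v) = 0 := by
  refine C.induction_vec v ?_ (fun v w hv hw => ?_) fun c x => ?_
  · simp
  · rw [map_add, inner_add_right, hv, hw, add_zero]
  · rw [map_smul, inner_smul_right, cons_vec, vacuum, inner_vec_vec]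
    simp

theorem inner_vacuum_rightMul (m : M.Elem) (v : C.PreFock) :
    inner ℂ C.vacuum (C.rightMul m v) = inner ℂ C.vacuum (C.leftMul m v) := by
  refine C.induction_vec v ?_ (fun v w hv hw => ?_) fun c ⟨l, a⟩ => ?_
  · simp
  · simp only [map_add, inner_add_right, hv, hw]
  · simp only [map_smul, inner_smul_right, vacuum]
    congr 1
    rw [inner_vec_leftMul_vec, rightMul_vec, inner_vec_vec]
    cases l with
    | nil => simpa using τ.mul_comm a m
    | cons p l => simp

/-- Only one-letter words contribute, and for them the claim is the duality `τ(η (!e) p * a) = τ(p *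
η e a)`. This is where the two maps of the covariance must be adjoint to each other. -/
theorem inner_vacuum_rightCirc (e) (v : C.PreFock) :
    inner ℂ C.vacuum (C.rightCirc e v) = inner ℂ C.vacuum (C.circ e v) := by
  refine C.induction_vec v ?_ (fun v w hv hw => ?_) fun c ⟨l, a⟩ => ?_
  · simp
  · simp only [map_add, inner_add_right, hv, hw]
  · simp only [map_smul, inner_smul_right]
    congr 1
    rw [circ, rightCirc, LinearMap.add_apply, LinearMap.add_apply, inner_add_right,
      inner_add_right, inner_vacuum_cons, zero_add]
    have h0 : inner ℂ C.vacuum (C.rightCreate e (C.vec (l, a))) = 0 := by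
      rw [rightCreate_vec, vacuum, inner_vec_vec]
      cases l <;> simp
    rw [h0, zero_add]
    rcases l with - | ⟨p, - | ⟨q, l⟩⟩
    · simp
    · rw [rightAnnih_vec_singleton, annih_vec_cons]
      split_ifs
      · rw [vacuum, inner_vec_leftMul_vec, inner_vec_vec]
        simp [C.dual]
      · rfl
    · rw [rightAnnih_vec_cons_cons, inner_vacuum_cons, annih_vec_cons]
      split_ifs
      · rw [vacuum, inner_vec_leftMul_vec]
        simp
      · simp

theorem rightMul_vacuum (m : M.Elem) : C.rightMul m C.vacuum = C.leftMul m C.vacuum := by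
  simp [vacuum]

theorem rightCirc_vacuum (e) : C.rightCirc e C.vacuum = C.circ e C.vacuum := by
  simp [vacuum, rightCirc, circ]

theorem norm_leftMul_le (m : M.Elem) (v : C.PreFock) : ‖C.leftMul m v‖ ≤ ‖m‖ * ‖v‖ := by
  obtain ⟨c, hc⟩ := exists_norm_sq_smul_one_eq m
  have h1 := C.inner_leftMul_smul ((‖m‖ ^ 2 : ℝ) : ℂ) 1 v v
  rw [hc, inner_leftMul_add, inner_add_right, leftMul_one, inner_smul_right, ← leftMul_leftMul,
    ← leftMul_leftMul, ← inner_leftMul_left, ← inner_leftMul_left] at h1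
  have h2 := congrArg Complex.re h1
  rw [Complex.add_re, Complex.re_ofReal_mul] at h2
  have h3 : ∀ w : C.PreFock, (inner ℂ w w).re = ‖w‖ ^ 2 := fun w =>
    (inner_self_eq_norm_sq (𝕜 := ℂ) w)
  rw [h3, h3, h3] at h2
  refine le_of_sq_le_sq ?_ (by positivity)
  rw [mul_pow]
  nlinarith [sq_nonneg ‖C.leftMul c v‖]

/-- Creation is isometric because `η e 1 = 1`. -/
theorem norm_cons_one (e) (v : C.PreFock) : ‖C.cons (1, e) v‖ = ‖v‖ := by
  have : inner ℂ (C.cons (1, e) v) (C.cons (1, e) v) = inner ℂ v v := by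
    rw [inner_cons_one, annih_cons, if_pos rfl, C.map_one, leftMul_one]
  rw [norm_eq_sqrt_re_inner (𝕜 := ℂ), this, ← norm_eq_sqrt_re_inner (𝕜 := ℂ)]

theorem norm_annih_le (e) (v : C.PreFock) : ‖C.annih e v‖ ≤ ‖v‖ := by
  have h : ‖C.annih e v‖ ^ 2 ≤ ‖C.annih e v‖ * ‖v‖ := by
    rw [← inner_self_eq_norm_sq (𝕜 := ℂ), ← inner_cons_one]
    refine (RCLike.re_le_norm _).trans ((norm_inner_le_norm _ _).trans_eq ?_)
    rw [norm_cons_one]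
  rcases (norm_nonneg (C.annih e v)).eq_or_lt with h0 | h0
  · rw [← h0]; exact norm_nonneg _
  · rw [sq] at h; exact le_of_mul_le_mul_left h h0

theorem norm_circ_le (e) (v : C.PreFock) : ‖C.circ e v‖ ≤ 2 * ‖v‖ := by
  rw [circ, LinearMap.add_apply]
  refine (norm_add_le _ _).trans ?_
  rw [norm_cons_one]
  linarith [C.norm_annih_le (!e) v]

end Covariance

end Trace

end VonNeumannAlgebra

end

/-! ### The trace of a cyclic tracial vector on the generated von Neumann algebra -/

noncomputable section

namespace VonNeumannAlgebra

variable {K : Type u} [NormedAddCommGroup K] [InnerProductSpace ℂ K] [CompleteSpace K]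

/-- The commutant of a set of operators and their adjoints. -/
def commutantOf (S : Set (K →L[ℂ] K)) : VonNeumannAlgebra K where
  toStarSubalgebra := StarSubalgebra.centralizer ℂ S
  centralizer_centralizer' := by
    have : (StarSubalgebra.centralizer ℂ S).carrier = Set.centralizer (S ∪ star S) := rfl
    rw [this, Set.centralizer_centralizer_centralizer]

/-- The von Neumann algebra generated by a `*`-algebra of operators. -/
def generated (A : StarSubalgebra ℂ (K →L[ℂ] K)) : VonNeumannAlgebra K :=
  (commutantOf (A : Set (K →L[ℂ] K))).commutant

variable {A : StarSubalgebra ℂ (K →L[ℂ] K)}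

theorem mem_generated_of_mem {a : K →L[ℂ] K} (ha : a ∈ A) : a ∈ generated A := by
  rw [generated, mem_commutant_iff]
  intro g hg
  exact (hg a (Or.inl ha)).symm

theorem commute_of_mem_generated {x T : K →L[ℂ] K} (hx : x ∈ generated A)
    (hT : ∀ a ∈ A, a * T = T * a) : x * T = T * x := by
  rw [generated, mem_commutant_iff] at hx
  refine (hx T ?_).symm
  rintro a (ha | ha)
  · exact hT a ha
  · exact hT a (by simpa using star_mem (s := A) (r := star a) ha)

/-- A unit vector that is cyclic for a `*`-algebra of operators and induces a trace on it. -/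
structure IsTracialVector (A : StarSubalgebra ℂ (K →L[ℂ] K)) (Ω : K) : Prop where
  norm_eq_one : ‖Ω‖ = 1
  cyclic : DenseRange fun a : A => (a : K →L[ℂ] K) Ω
  tracial : ∀ a ∈ A, ∀ b ∈ A, inner ℂ Ω ((a * b) Ω) = inner ℂ Ω ((b * a) Ω)

namespace IsTracialVector

variable {Ω : K}

theorem norm_star_apply (h : IsTracialVector A Ω) {a : K →L[ℂ] K} (ha : a ∈ A) :
    ‖star a Ω‖ = ‖a Ω‖ := by
  have h1 := h.tracial a ha (star a) (star_mem ha)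
  rw [mul_apply_eq_comp, mul_apply_eq_comp, ContinuousLinearMap.star_eq_adjoint,
    ContinuousLinearMap.adjoint_inner_right, ← ContinuousLinearMap.adjoint_inner_left,
    inner_self_eq_norm_sq_to_K, inner_self_eq_norm_sq_to_K] at h1
  norm_cast at h1
  exact (sq_eq_sq₀ (norm_nonneg _) (norm_nonneg _)).1 h1

/-- Right multiplication is bounded by traciality: `‖a b Ω‖ = ‖b* a* Ω‖ ≤ ‖b*‖ ‖a* Ω‖ = ‖b*‖ ‖a Ω‖`.
-/
theorem exists_rightMul (h : IsTracialVector A Ω) {b : K →L[ℂ] K} (hb : b ∈ A) :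
    ∃ R : K →L[ℂ] K, ∀ a ∈ A, R (a Ω) = a (b Ω) := by
  let e : A →ₗ[ℂ] K := (LinearMap.applyₗ Ω ∘ₗ ContinuousLinearMap.coeLM ℂ) ∘ₗ
    A.subtype.toLinearMap
  let f : A →ₗ[ℂ] K := (LinearMap.applyₗ (b Ω) ∘ₗ ContinuousLinearMap.coeLM ℂ) ∘ₗ
    A.subtype.toLinearMap
  have hd : DenseRange e := h.cyclic
  have hn : ∃ C, ∀ a, ‖f a‖ ≤ C * ‖e a‖ := by
    refine ⟨‖star b‖, fun a => ?_⟩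
    have h1 : ‖f a‖ = ‖(star (a.1 * b)) Ω‖ := (h.norm_star_apply (A.mul_mem a.2 hb)).symm
    rw [h1, star_mul]
    refine ((star b).le_opNorm _).trans_eq (congrArg (‖star b‖ * ·) ?_)
    exact h.norm_star_apply a.2
  refine ⟨f.extendOfNorm e, fun a ha => ?_⟩
  exact LinearMap.extendOfNorm_eq hd hn ⟨a, ha⟩

theorem exists_rightMul_commute (h : IsTracialVector A Ω) {b : K →L[ℂ] K} (hb : b ∈ A) :
    ∃ R : K →L[ℂ] K, R Ω = b Ω ∧ star R Ω = star b Ω ∧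
      ∀ x ∈ generated A, x * R = R * x := by
  obtain ⟨R, hR⟩ := h.exists_rightMul hb
  refine ⟨R, by simpa using hR 1 A.one_mem, ?_, fun x hx => commute_of_mem_generated hx ?_⟩
  · refine h.cyclic.eq_of_inner_left (𝕜 := ℂ) fun a => ?_
    rw [ContinuousLinearMap.star_eq_adjoint, ContinuousLinearMap.star_eq_adjoint,
      ContinuousLinearMap.adjoint_inner_left, ContinuousLinearMap.adjoint_inner_left, hR a.1 a.2]
    exact h.tracial a.1 a.2 b hb
  · intro a ha
    refine ContinuousLinearMap.coeFn_injective
      (h.cyclic.equalizer (a * R).continuous (R * a).continuous (funext fun c => ?_))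
    have := hR (a * c.1) (A.mul_mem ha c.2)
    simp only [mul_apply_eq_comp, Function.comp_apply] at this ⊢
    rw [this, hR c.1 c.2]

/-- Extends traciality to the bicommutant without a density theorem. With `R` the right
multiplication by `b`, `⟨x* Ω, b Ω⟩ = ⟨Ω, x R Ω⟩ = ⟨R* Ω, x Ω⟩`, and `‖R* Ω‖ = ‖b* Ω‖ = ‖b Ω‖`. -/
theorem norm_star_apply_le (h : IsTracialVector A Ω) {x : K →L[ℂ] K} (hx : x ∈ generated A) :
    ‖star x Ω‖ ≤ ‖x Ω‖ := by
  have key : ∀ v : K, ‖inner ℂ (star x Ω) v‖ ≤ ‖x Ω‖ * ‖v‖ := by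
    refine fun v => h.cyclic.induction (P := fun v => ‖inner ℂ (star x Ω) v‖ ≤ ‖x Ω‖ * ‖v‖)
      ?_ (isClosed_le (by fun_prop) (by fun_prop)) v
    rintro _ ⟨b, rfl⟩
    obtain ⟨R, hR1, hR2, hR3⟩ := h.exists_rightMul_commute b.2
    have hxR : x (R Ω) = R (x Ω) := congrArg (fun T : K →L[ℂ] K => T Ω) (hR3 x hx)
    dsimp only
    rw [ContinuousLinearMap.star_eq_adjoint, ContinuousLinearMap.adjoint_inner_left, ← hR1, hxR,
      ← ContinuousLinearMap.adjoint_inner_left, ← ContinuousLinearMap.star_eq_adjoint, hR2, hR1,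
      _root_.mul_comm, ← h.norm_star_apply b.2]
    exact norm_inner_le_norm _ _
  have h1 := key (star x Ω)
  rw [inner_self_eq_norm_sq_to_K] at h1
  simp only [norm_pow, RCLike.norm_ofReal, abs_norm] at h1
  rcases (norm_nonneg (star x Ω)).eq_or_lt with h0 | h0
  · rw [← h0]; exact norm_nonneg _
  · rw [sq] at h1; exact le_of_mul_le_mul_right h1 h0

theorem norm_star_apply_of_mem (h : IsTracialVector A Ω) {x : K →L[ℂ] K}
    (hx : x ∈ generated A) : ‖star x Ω‖ = ‖x Ω‖ :=
  le_antisymm (h.norm_star_apply_le hx) (by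
    simpa using h.norm_star_apply_le (star_mem hx))

theorem inner_mul_star_self (h : IsTracialVector A Ω) {x : K →L[ℂ] K} (hx : x ∈ generated A) :
    inner ℂ Ω ((x * star x) Ω) = inner ℂ Ω ((star x * x) Ω) := by
  rw [mul_apply_eq_comp, mul_apply_eq_comp, ContinuousLinearMap.star_eq_adjoint,
    ContinuousLinearMap.adjoint_inner_right, ← ContinuousLinearMap.adjoint_inner_left,
    inner_self_eq_norm_sq_to_K, inner_self_eq_norm_sq_to_K,
    ← ContinuousLinearMap.star_eq_adjoint, h.norm_star_apply_of_mem hx]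

theorem inner_mul_star (h : IsTracialVector A Ω) {x y : K →L[ℂ] K} (hx : x ∈ generated A)
    (hy : y ∈ generated A) : inner ℂ Ω ((x * star y) Ω) = inner ℂ Ω ((star y * x) Ω) := by
  have hIy : Complex.I • y ∈ generated A := (generated A).toStarSubalgebra.smul_mem hy _
  have h1 := h.inner_mul_star_self (add_mem hx hy)
  have h2 := h.inner_mul_star_self (add_mem hx hIy)
  have hxx := h.inner_mul_star_self hx
  have hyy := h.inner_mul_star_self hy
  simp only [star_add, star_smul, add_mul, mul_add, smul_mul_assoc, mul_smul_comm,
    add_apply, smul_apply, inner_add_right,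
    inner_smul_right, Complex.star_def, Complex.conj_I] at h1 h2
  have hI := Complex.I_mul_I
  -- Polarization of `inner_mul_star_self` at `x + y` and `x + i y`.
  linear_combination (1 / 2 : ℂ) * h1 + (Complex.I / 2) * h2 - (1 / 2 : ℂ) * (1 + Complex.I) * hxx
    - (1 / 2 : ℂ) * (1 + Complex.I) * hyy + (1 / 2 : ℂ) * (inner ℂ Ω ((x * star y) Ω) -
      inner ℂ Ω ((star y * x) Ω) + inner ℂ Ω ((star x * y) Ω) - inner ℂ Ω ((y * star x) Ω) +
      Complex.I * (inner ℂ Ω ((y * star y) Ω) - inner ℂ Ω ((star y * y) Ω))) * hI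

/-- The trace defined by a tracial vector on the generated von Neumann algebra. -/
def trace (h : IsTracialVector A Ω) : Trace (generated A) where
  toLinearMap :=
    { toFun := fun x => inner ℂ Ω ((x : K →L[ℂ] K) Ω)
      map_add' := fun x y => inner_add_right _ _ _
      map_smul' := fun c x => inner_smul_right _ _ _ }
  map_one := by
    show inner ℂ Ω Ω = 1
    rw [inner_self_eq_norm_sq_to_K, h.norm_eq_one]
    simp
  pos x hx := by
    have := hx.inner_nonneg_right Ω
    exact ⟨(Complex.le_def.1 this).1, (Complex.le_def.1 this).2.symm⟩
  mul_comm x y := by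
    have := h.inner_mul_star x.2 (star_mem y.2)
    rwa [star_star] at this
  faithful x hx := by
    have h0 : (x : K →L[ℂ] K) Ω = 0 := by
      have h1 : inner ℂ Ω ((star (x : K →L[ℂ] K) * (x : K →L[ℂ] K)) Ω) = 0 := hx
      rwa [mul_apply_eq_comp, ContinuousLinearMap.star_eq_adjoint,
        ContinuousLinearMap.adjoint_inner_right, inner_self_eq_zero] at h1
    -- From `x Ω = 0` follows `x b Ω = x R Ω = R x Ω = 0`, and the vectors `b Ω` are dense.
    refine Subtype.ext (ContinuousLinearMap.coeFn_injective
      (h.cyclic.equalizer x.1.continuous continuous_zero (funext fun b => ?_)))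
    obtain ⟨R, hR1, -, hR3⟩ := h.exists_rightMul_commute b.2
    have hxR : x.1 (R Ω) = R (x.1 Ω) := congrArg (fun T : K →L[ℂ] K => T Ω) (hR3 x.1 x.2)
    rw [Function.comp_apply, ← hR1, hxR, h0, map_zero]
    rfl
  normal := by
    refine ⟨fun n => if n = 0 then Ω else 0, fun n => if n = 0 then Ω else 0, ?_, ?_, fun x => ?_⟩
    · exact summable_of_ne_finset_zero (s := {0}) fun n hn => by
        simp [show n ≠ 0 by simpa using hn]
    · exact summable_of_ne_finset_zero (s := {0}) fun n hn => by
        simp [show n ≠ 0 by simpa using hn]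
    · have := hasSum_single (f := fun n : ℕ => inner ℂ (if n = 0 then Ω else 0)
        ((x : K →L[ℂ] K) (if n = 0 then Ω else 0))) 0
        fun n hn => by rw [if_neg hn, inner_zero_left]
      simpa only [if_pos] using! this

theorem norm2_trace (h : IsTracialVector A Ω) (x : (generated A).Elem) :
    h.trace.norm2 x = ‖(x : K →L[ℂ] K) Ω‖ := by
  refine (sq_eq_sq₀ (h.trace.norm2_nonneg _) (norm_nonneg _)).1 ?_
  have h1 : h.trace (star x * x)
      = inner ℂ Ω ((star (x : K →L[ℂ] K)) ((x : K →L[ℂ] K) Ω)) := rfl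
  rw [Trace.norm2_sq, h1, ContinuousLinearMap.star_eq_adjoint,
    ContinuousLinearMap.adjoint_inner_right, ← inner_self_eq_norm_sq (𝕜 := ℂ)]
  rfl

end IsTracialVector

end VonNeumannAlgebra

end

/-! ### The Fock space representation and its vacuum trace -/

noncomputable section

namespace VonNeumannAlgebra

namespace Trace

namespace Covariance

variable {H : Type u} [NormedAddCommGroup H] [InnerProductSpace ℂ H] [CompleteSpace H]
  {M : VonNeumannAlgebra H} {τ : Trace M} (C : Covariance τ)

/-- The Fock space of a covariance. -/
abbrev Fock : Type u := UniformSpace.Completion C.PreFock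

/-- The class of a vector of the algebraic Fock space. -/
abbrev toFock (v : C.PreFock) : C.Fock := v

@[simp] theorem toFock_zero : C.toFock 0 = 0 := UniformSpace.Completion.coe_zero

theorem fock_ext {S T : C.Fock →L[ℂ] C.Fock} (h : ∀ v, S (C.toFock v) = T (C.toFock v)) :
    S = T :=
  ContinuousLinearMap.coeFn_injective
    (UniformSpace.Completion.denseRange_coe.equalizer S.continuous T.continuous (funext h))

/-- The completion kills null vectors, so relations known inside inner products become equalities.
-/
theorem toFock_eq_of_inner {v w : C.PreFock} (h : ∀ u, inner ℂ u v = inner ℂ u w) :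
    C.toFock v = C.toFock w := by
  rw [← sub_eq_zero, ← UniformSpace.Completion.coe_sub, ← norm_eq_zero,
    UniformSpace.Completion.norm_coe, ← sq_eq_zero_iff, ← inner_self_eq_norm_sq (𝕜 := ℂ),
    inner_sub_right, h, sub_self, map_zero]

/-- The representation of `M` on the Fock space. -/
def rep : M.Elem →⋆ₐ[ℂ] (C.Fock →L[ℂ] C.Fock) where
  toFun m := ((C.leftMul m).mkContinuous ‖m‖ (C.norm_leftMul_le m)).completion
  map_one' := C.fock_ext fun v => by simp [leftMul_one]
  map_mul' m m' := C.fock_ext fun v => by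
    simp [mul_apply_eq_comp, leftMul_leftMul]
  map_zero' := C.fock_ext fun v => by
    simp only [ContinuousLinearMap.completion_apply_coe, LinearMap.mkContinuous_apply]
    refine (C.toFock_eq_of_inner (w := 0) fun u => ?_).trans C.toFock_zero
    have := C.inner_leftMul_smul 0 0 u v
    rwa [zero_smul, zero_smul] at this
  map_add' m m' := C.fock_ext fun v => by
    simp only [ContinuousLinearMap.completion_apply_coe, LinearMap.mkContinuous_apply, add_apply,
      ← UniformSpace.Completion.coe_add]
    exact C.toFock_eq_of_inner fun u => C.inner_leftMul_add m m' u v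
  commutes' c := C.fock_ext fun v => by
    rw [Algebra.algebraMap_eq_smul_one, Algebra.algebraMap_eq_smul_one]
    simp only [ContinuousLinearMap.completion_apply_coe, LinearMap.mkContinuous_apply, smul_apply,
      one_apply_eq_self, ← UniformSpace.Completion.coe_smul]
    refine C.toFock_eq_of_inner fun u => ?_
    rw [inner_leftMul_smul, leftMul_one]
  map_star' m := by
    refine (ContinuousLinearMap.eq_adjoint_iff _ _).2 fun v w => ?_
    induction v, w using UniformSpace.Completion.induction_on₂ with
    | hp => apply isClosed_eq <;> fun_prop
    | ih v w => simp [inner_leftMul_left]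

theorem rep_apply (m : M.Elem) (v : C.PreFock) :
    C.rep m (C.toFock v) = C.toFock (C.leftMul m v) :=
  ContinuousLinearMap.completion_apply_coe _ _

/-- The circular operator on the Fock space. -/
def circOp (e : Bool) : C.Fock →L[ℂ] C.Fock :=
  ((C.circ e).mkContinuous 2 (C.norm_circ_le e)).completion

theorem circOp_apply (e) (v : C.PreFock) :
    C.circOp e (C.toFock v) = C.toFock (C.circ e v) :=
  ContinuousLinearMap.completion_apply_coe _ _

theorem star_circOp (e) : star (C.circOp e) = C.circOp (!e) := by
  symm
  refine (ContinuousLinearMap.eq_adjoint_iff _ _).2 fun v w => ?_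
  induction v, w using UniformSpace.Completion.induction_on₂ with
  | hp => apply isClosed_eq <;> fun_prop
  | ih v w =>
    have h1 := C.circOp_apply (!e) v
    have h2 := C.circOp_apply e w
    simp only [toFock] at h1 h2
    rw [h1, h2, UniformSpace.Completion.inner_coe, UniformSpace.Completion.inner_coe,
      inner_circ_left, Bool.not_not]

/-- The generators of the Fock algebra. -/
def generators : Set (C.Fock →L[ℂ] C.Fock) := Set.range C.rep ∪ Set.range C.circOp

theorem star_generators : star C.generators = C.generators := by
  have h : ∀ a ∈ C.generators, star a ∈ C.generators := by
    rintro _ (⟨m, rfl⟩ | ⟨e, rfl⟩)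
    · exact Or.inl ⟨star m, StarHomClass.map_star C.rep m⟩
    · exact Or.inr ⟨!e, (C.star_circOp e).symm⟩
  ext a
  refine ⟨fun ha => ?_, fun ha => h a ha⟩
  simpa using h _ ha

/-- The `*`-algebra generated by `M` and the circular operators. -/
def fockAlgebra : StarSubalgebra ℂ (C.Fock →L[ℂ] C.Fock) := StarAlgebra.adjoin ℂ C.generators

/-- The generators are closed under `star`, so inductions over this algebra need no case for
adjoints. -/
theorem mem_fockAlgebra_iff {a : C.Fock →L[ℂ] C.Fock} :
    a ∈ C.fockAlgebra ↔ a ∈ Algebra.adjoin ℂ C.generators := by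
  rw [fockAlgebra, ← StarSubalgebra.mem_toSubalgebra, StarAlgebra.adjoin_toSubalgebra,
    star_generators, Set.union_self]

theorem rep_mem (m : M.Elem) : C.rep m ∈ C.fockAlgebra :=
  StarAlgebra.subset_adjoin ℂ _ (Or.inl ⟨m, rfl⟩)

theorem circOp_mem (e) : C.circOp e ∈ C.fockAlgebra :=
  StarAlgebra.subset_adjoin ℂ _ (Or.inr ⟨e, rfl⟩)

/-- Elements of the Fock algebra act on the algebraic Fock space and commute with the right
operators there. -/
theorem exists_end_of_mem {a : C.Fock →L[ℂ] C.Fock} (ha : a ∈ C.fockAlgebra) :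
    ∃ T : Module.End ℂ C.PreFock, (∀ m, Commute T (C.rightMul m)) ∧
      (∀ e, Commute T (C.rightCirc e)) ∧ ∀ v, a (C.toFock v) = C.toFock (T v) := by
  rw [mem_fockAlgebra_iff] at ha
  induction ha using Algebra.adjoin_induction with
  | mem a ha =>
    rcases ha with ⟨m, rfl⟩ | ⟨e, rfl⟩
    · exact ⟨C.leftMul m, C.commute_leftMul_rightMul m, C.commute_leftMul_rightCirc m,
        C.rep_apply m⟩
    · exact ⟨C.circ e, C.commute_circ_rightMul e, C.commute_circ_rightCirc e, C.circOp_apply e⟩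
  | algebraMap c =>
    refine ⟨algebraMap ℂ _ c, fun m => Algebra.commutes c _, fun e => Algebra.commutes c _,
      fun v => ?_⟩
    simp [Algebra.algebraMap_eq_smul_one, UniformSpace.Completion.coe_smul]
  | add a b _ _ ha hb =>
    obtain ⟨S, hS1, hS2, hS3⟩ := ha
    obtain ⟨T, hT1, hT2, hT3⟩ := hb
    refine ⟨S + T, fun m => (hS1 m).add_left (hT1 m), fun e => (hS2 e).add_left (hT2 e),
      fun v => ?_⟩
    rw [add_apply, hS3, hT3, LinearMap.add_apply, toFock, toFock, toFock,
      UniformSpace.Completion.coe_add]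
  | mul a b _ _ ha hb =>
    obtain ⟨S, hS1, hS2, hS3⟩ := ha
    obtain ⟨T, hT1, hT2, hT3⟩ := hb
    refine ⟨S * T, fun m => (hS1 m).mul_left (hT1 m), fun e => (hS2 e).mul_left (hT2 e),
      fun v => ?_⟩
    rw [mul_apply_eq_comp, hT3, hS3, Module.End.mul_apply]

/-- The vacuum vector of the Fock space. -/
def Ω : C.Fock := C.toFock C.vacuum

theorem inner_Ω_toFock (v : C.PreFock) : inner ℂ C.Ω (C.toFock v) = inner ℂ C.vacuum v :=
  UniformSpace.Completion.inner_coe _ _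

/-- Each generator `g` has a right version `g'` that commutes with `b`, agrees with `g` on the
vacuum and has the same vacuum functional. Hence `⟨Ω, b g Ω⟩ = ⟨Ω, b g' Ω⟩ = ⟨Ω, g' b Ω⟩ = ⟨Ω, g b
Ω⟩`. -/
theorem inner_mul_generator {g : C.Fock →L[ℂ] C.Fock} (hg : g ∈ C.generators)
    {b : C.Fock →L[ℂ] C.Fock} (hb : b ∈ C.fockAlgebra) :
    inner ℂ C.Ω ((b * g) C.Ω) = inner ℂ C.Ω ((g * b) C.Ω) := by
  obtain ⟨T, hT1, hT2, hT3⟩ := C.exists_end_of_mem hb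
  rw [mul_apply_eq_comp, mul_apply_eq_comp, Ω, hT3]
  rcases hg with ⟨m, rfl⟩ | ⟨e, rfl⟩
  · rw [rep_apply, rep_apply, hT3, ← Ω, inner_Ω_toFock, inner_Ω_toFock, ← rightMul_vacuum,
      ← inner_vacuum_rightMul]
    exact congrArg (fun S : Module.End ℂ C.PreFock => inner ℂ C.vacuum (S C.vacuum)) (hT1 m).eq
  · rw [circOp_apply, circOp_apply, hT3, ← Ω, inner_Ω_toFock, inner_Ω_toFock, ← rightCirc_vacuum,
      ← inner_vacuum_rightCirc]
    exact congrArg (fun S : Module.End ℂ C.PreFock => inner ℂ C.vacuum (S C.vacuum)) (hT2 e).eq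

theorem inner_mul_comm {a b : C.Fock →L[ℂ] C.Fock} (ha : a ∈ C.fockAlgebra)
    (hb : b ∈ C.fockAlgebra) :
    inner ℂ C.Ω ((a * b) C.Ω) = inner ℂ C.Ω ((b * a) C.Ω) := by
  rw [mem_fockAlgebra_iff] at ha
  induction ha using Algebra.adjoin_induction generalizing b with
  | mem a ha => exact (C.inner_mul_generator ha hb).symm
  | algebraMap c => rw [Algebra.commutes]
  | add a a' _ _ h h' =>
    rw [add_mul, mul_add, add_apply, add_apply, inner_add_right, inner_add_right, h hb, h' hb]
  | mul a a' ha ha' h h' =>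
    rw [← mem_fockAlgebra_iff] at ha ha'
    rw [mul_assoc, h (mul_mem ha' hb), mul_assoc, h' (mul_mem hb ha), mul_assoc]

/-- A word `m e w` is `m` applied to the circular operator on `w` minus an annihilation term. That
term is zero or two letters shorter than the word, so strong induction on the length applies. -/
theorem exists_apply_Ω_eq_vec (x : Word M) :
    ∃ a ∈ C.fockAlgebra, a C.Ω = C.toFock (C.vec x) := by
  obtain ⟨l, b⟩ := x
  induction hn : l.length using Nat.strong_induction_on generalizing l with
  | _ n ih =>
    rcases l with - | ⟨⟨m, e⟩, l⟩
    · refine ⟨C.rep b, C.rep_mem b, ?_⟩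
      rw [Ω, rep_apply, vacuum, leftMul_vec, mulWord_nil, mul_one]
    · rw [List.length_cons] at hn
      obtain ⟨a, ha, ha'⟩ := ih l.length (by omega) l rfl
      obtain ⟨d, hd, hd'⟩ : ∃ d ∈ C.fockAlgebra,
          d C.Ω = C.toFock (C.annih (!e) (C.vec (l, b))) := by
        rcases l with - | ⟨p, l⟩
        · exact ⟨0, zero_mem _, by rw [annih_vec_nil, toFock_zero]; rfl⟩
        · rw [annih_vec_cons]
          split_ifs
          · rw [List.length_cons] at hn
            obtain ⟨d, hd, hd'⟩ := ih l.length (by omega) l rfl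
            refine ⟨C.rep (C.η (!e) p.1) * d, mul_mem (C.rep_mem _) hd, ?_⟩
            rw [mul_apply_eq_comp, hd', rep_apply]
          · exact ⟨0, zero_mem _, C.toFock_zero.symm⟩
      refine ⟨C.rep m * (C.circOp e * a - d),
        mul_mem (C.rep_mem m) (sub_mem (mul_mem (C.circOp_mem e) ha) hd), ?_⟩
      rw [mul_apply_eq_comp, sub_apply, mul_apply_eq_comp, ha', hd', circOp_apply, toFock, toFock,
        ← UniformSpace.Completion.coe_sub, circ, LinearMap.add_apply, add_sub_cancel_right,
        cons_vec]
      refine (C.rep_apply _ _).trans ?_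
      rw [leftMul_vec, mulWord_cons, mul_one]

theorem isTracialVector_Ω : IsTracialVector C.fockAlgebra C.Ω where
  norm_eq_one := by
    rw [Ω, UniformSpace.Completion.norm_coe, ← sq_eq_sq₀ (norm_nonneg _) zero_le_one,
      ← inner_self_eq_norm_sq (𝕜 := ℂ), vacuum, inner_vec_vec]
    simp [τ.map_one]
  cyclic := by
    refine UniformSpace.Completion.denseRange_coe.mono ?_
    rintro _ ⟨v, rfl⟩
    refine C.induction_vec v ?_ (fun v w hv hw => ?_) fun c x => ?_
    · exact ⟨0, C.toFock_zero.symm⟩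
    · obtain ⟨a, ha⟩ := hv
      obtain ⟨b, hb⟩ := hw
      refine ⟨a + b, ?_⟩
      rw [UniformSpace.Completion.coe_add, ← ha, ← hb]
      rfl
    · obtain ⟨a, ha, hax⟩ := C.exists_apply_Ω_eq_vec x
      refine ⟨c • ⟨a, ha⟩, ?_⟩
      rw [UniformSpace.Completion.coe_smul]
      exact congrArg (c • ·) hax
  tracial a ha b hb := C.inner_mul_comm ha hb

theorem annih_leftMul {e : Bool} {m m' : M.Elem} (h : ∀ b, C.η e (m * b) = m' * C.η e b)
    (v : C.PreFock) : C.annih e (C.leftMul m v) = C.leftMul m' (C.annih e v) := by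
  rw [← LinearMap.comp_apply, ← LinearMap.comp_apply]
  refine LinearMap.congr_fun ?_ v
  refine C.hom_ext fun ⟨l, a⟩ => ?_
  rcases l with - | ⟨p, l⟩
  · simp
  · simp only [LinearMap.comp_apply, leftMul_vec, mulWord_cons, annih_vec_cons]
    split_ifs
    · rw [h, ← leftMul_vec, ← leftMul_vec, leftMul_leftMul]
    · rw [map_zero]

/-- The annihilation part intertwines by the module property of `η false`. The creation part does so
only modulo null vectors, and is treated through its adjoint, the annihilation for `η true`; hence
the stars in the first hypothesis. -/
theorem rep_mul_circOp {x x' : M.Elem} (h : ∀ b, C.η true (star x * b) = star x' * C.η true b)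
    (h' : ∀ b, C.η false (x' * b) = x * C.η false b) :
    C.rep x * C.circOp true = C.circOp true * C.rep x' := by
  refine C.fock_ext fun v => ?_
  rw [mul_apply_eq_comp, mul_apply_eq_comp, circOp_apply, rep_apply, rep_apply, circOp_apply]
  refine C.toFock_eq_of_inner fun u => ?_
  rw [circ, LinearMap.add_apply, LinearMap.add_apply, map_add, inner_add_right, inner_add_right,
    Bool.not_true, C.annih_leftMul h']
  refine congrArg₂ (· + ·) ?_ rfl
  have hadj : ∀ u w, inner ℂ u (C.cons (1, true) w) = inner ℂ (C.annih true u) w := fun u w => by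
    rw [← inner_conj_symm, inner_cons_one, inner_conj_symm]
  have hl : inner ℂ u (C.leftMul x (C.cons (1, true) v))
      = inner ℂ (C.leftMul (star x) u) (C.cons (1, true) v) := by
    rw [inner_leftMul_left, star_star]
  rw [hl, hadj, hadj, C.annih_leftMul h, inner_leftMul_left, star_star]

end Covariance

end Trace

end VonNeumannAlgebra

end

/-! ### An almost unitary element from the circular element -/

noncomputable section

/-- With `c = (y* y + δ)^(-1/2)`, the element `y c` fails to be isometric only by the element
`δ (y* y + δ)⁻¹`. -/
theorem exists_star_mul_self_eq_one_sub {A : Type*} [CStarAlgebra A] (y : A) {δ : ℝ} (hδ : 0 < δ) :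
    ∃ c D : A, star (y * c) * (y * c) = 1 - D ∧ ‖D‖ ≤ 1 ∧ ‖D * (star y * y)‖ ≤ δ ∧
      ∀ z, Commute (star y * y) z → Commute c z := by
  have hT0 : ∀ t ∈ spectrum ℝ (star y * y), 0 ≤ t := spectrum_star_mul_self_nonneg
  have hpos : ∀ t ∈ spectrum ℝ (star y * y), 0 < t + δ := fun t ht => by linarith [hT0 t ht]
  have hg : ContinuousOn (fun t : ℝ => (√(t + δ))⁻¹) (spectrum ℝ (star y * y)) :=
    ContinuousOn.inv₀ (by fun_prop) fun t ht => (Real.sqrt_pos.2 (hpos t ht)).ne'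
  have hd : ContinuousOn (fun t : ℝ => δ / (t + δ)) (spectrum ℝ (star y * y)) :=
    ContinuousOn.div (by fun_prop) (by fun_prop) fun t ht => (hpos t ht).ne'
  have hT : IsSelfAdjoint (star y * y) := IsSelfAdjoint.star_mul_self y
  refine ⟨cfc (fun t : ℝ => (√(t + δ))⁻¹) (star y * y), cfc (fun t : ℝ => δ / (t + δ)) (star y * y),
    ?_, ?_, ?_, fun z hz => hz.cfc_real _⟩
  · have h1 : (1 : A) - cfc (fun t : ℝ => δ / (t + δ)) (star y * y) =
        cfc (fun t : ℝ => 1 - δ / (t + δ)) (star y * y) := by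
      rw [cfc_sub (fun _ => 1) _ _ (by fun_prop) hd, cfc_const_one ℝ (star y * y)]
    rw [star_mul_cfc_mul_mul_cfc y hg, h1]
    refine cfc_congr fun t ht => ?_
    have h1 := Real.mul_self_sqrt (hpos t ht).le
    have h2 := Real.sqrt_pos.2 (hpos t ht)
    have h3 := hpos t ht
    have h4 : (√(t + δ))⁻¹ * (t * (√(t + δ))⁻¹) = t / (t + δ) := by
      rw [div_eq_mul_inv, ← h1, mul_inv, h1]; ring
    rw [h4]
    field_simp
    ring
  · refine norm_cfc_le zero_le_one fun t ht => ?_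
    have := hpos t ht
    rw [Real.norm_of_nonneg (by positivity), div_le_one this]
    linarith [hT0 t ht]
  · have : cfc (fun t : ℝ => δ / (t + δ)) (star y * y) * (star y * y)
        = cfc (fun t : ℝ => δ / (t + δ) * t) (star y * y) := by
      rw [cfc_mul _ _ _ hd (by fun_prop), cfc_id' ℝ (star y * y)]
    rw [this]
    refine norm_cfc_le hδ.le fun t ht => ?_
    have h1 := hpos t ht
    have h2 := hT0 t ht
    rw [Real.norm_of_nonneg (by positivity), div_mul_eq_mul_div, div_le_iff₀ h1]
    nlinarith

namespace VonNeumannAlgebra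

namespace Trace

variable {H : Type u} [NormedAddCommGroup H] [InnerProductSpace ℂ H] [CompleteSpace H]
  {M : VonNeumannAlgebra H} {τ : Trace M}

/-- If `1` is in the `‖·‖₂`-closure of `y* y M`, then `y` has an almost unitary multiple by an
element of the algebra generated by `y* y`. -/
theorem exists_almost_unitary_mul (τ : Trace M) (y : M.Elem)
    (hy : ∀ ε : ℝ, 0 < ε → ∃ r : M.Elem, τ.norm2 (1 + star y * y * r) ≤ ε) {ε : ℝ} (hε : 0 < ε) :
    ∃ c : M.Elem, τ.norm2 (star (y * c) * (y * c) - 1) ≤ ε ∧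
      ∀ z, Commute (star y * y) z → Commute c z := by
  obtain ⟨r, hr⟩ := hy (ε / 2) (by positivity)
  obtain ⟨δ, hδ, hδr⟩ : ∃ δ : ℝ, 0 < δ ∧ δ * ‖r‖ ≤ ε / 2 := by
    refine ⟨ε / 2 / (‖r‖ + 1), by positivity, ?_⟩
    rw [div_mul_eq_mul_div, div_le_iff₀ (by positivity)]
    nlinarith [norm_nonneg r]
  obtain ⟨c, D, e1, hD1, hDT, hc⟩ := exists_star_mul_self_eq_one_sub y hδ
  refine ⟨c, ?_, hc⟩
  -- The first term is small in `‖·‖₂` since `‖D‖ ≤ 1`, the second in operator norm since `‖D y* y‖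
  -- ≤ δ`; `δ` was chosen after `r`.
  have e2 : D = D * (1 + star y * y * r) - D * (star y * y) * r := by
    rw [mul_add, mul_one, mul_assoc D, add_sub_cancel_right]
  rw [e1, sub_sub_cancel_left, norm2_neg, e2]
  refine (τ.norm2_sub _ _).trans ?_
  have h1 : τ.norm2 (D * (1 + star y * y * r)) ≤ ε / 2 :=
    (τ.norm2_mul_le _ _).trans ((mul_le_of_le_one_left (τ.norm2_nonneg _) hD1).trans hr)
  have h2 : τ.norm2 (D * (star y * y) * r) ≤ ε / 2 :=
    (τ.norm2_le_norm _).trans ((norm_mul_le _ _).trans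
      ((mul_le_mul_of_nonneg_right hDT (norm_nonneg _)).trans hδr))
  linarith

namespace Covariance

variable (C : Covariance τ)

/-- The letters of an alternating word. -/
def altLetter (n : ℕ) : Bool := decide (Even n)

theorem altLetter_succ (n : ℕ) : altLetter (n + 1) = !altLetter n := by
  simp [altLetter, Nat.even_add_one, -Nat.not_even_iff_odd]

/-- The alternating words with trivial coefficients. -/
def altWord (M : VonNeumannAlgebra H) : ℕ → List (M.Elem × Bool)
  | 0 => []
  | n + 1 => (1, altLetter n) :: altWord M n

theorem kernel_altWord (n m : ℕ) :
    C.kernel (altWord M n) (altWord M m) 1 1 1 = if n = m then 1 else 0 := by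
  induction n generalizing m with
  | zero => cases m <;> simp [altWord]
  | succ n ih =>
    cases m with
    | zero => simp [altWord]
    | succ m =>
      simp only [altWord, kernel_cons_cons, star_one, one_mul, C.map_one, ih]
      by_cases h : n = m
      · simp [h]
      · simp [h]

/-- The vector of an alternating word. -/
def altVec (n : ℕ) : C.PreFock := C.vec (altWord M n, 1)

theorem inner_altVec (n m : ℕ) : inner ℂ (C.altVec n) (C.altVec m) = if n = m then 1 else 0 := by
  rw [altVec, altVec, inner_vec_vec, kernel_altWord]
  split_ifs
  · exact τ.map_one
  · exact map_zero _

theorem circ_altVec_zero : C.circ true (C.altVec 0) = C.altVec 1 := by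
  simp [circ, altVec, altWord, altLetter]

/-- The three-term Chebyshev recursion. Unitality of `η` makes its coefficients `1`. -/
theorem circ_altVec_succ (n : ℕ) : C.circ (altLetter (n + 1)) (C.altVec (n + 1)) =
    C.altVec (n + 2) + C.altVec n := by
  have h : C.annih (!altLetter (n + 1)) (C.altVec (n + 1)) = C.altVec n := by
    rw [altVec, altWord, annih_vec_cons, if_pos (by rw [altLetter_succ, Bool.not_not]), C.map_one,
      leftMul_one, altVec]
  rw [circ, LinearMap.add_apply, h]
  simp [altVec, altWord]

/-- The von Neumann algebra generated by `M` and the circular operators on the Fock space. -/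
abbrev fockVN : VonNeumannAlgebra C.Fock := generated C.fockAlgebra

/-- The vacuum trace. -/
def fockTrace : Trace C.fockVN := C.isTracialVector_Ω.trace

/-- The embedding of `M` into the Fock von Neumann algebra. -/
def embed : M.Elem →⋆ₐ[ℂ] C.fockVN.Elem :=
  C.rep.codRestrict C.fockVN.toStarSubalgebra fun m => mem_generated_of_mem (C.rep_mem m)

theorem preserves_embed : τ.Preserves C.fockTrace C.embed := fun m => by
  have : C.fockTrace (C.embed m) = inner ℂ C.Ω (C.rep m C.Ω) := rfl
  rw [this, Ω, rep_apply, ← Ω, inner_Ω_toFock, vacuum, inner_vec_leftMul_vec]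
  simp

/-- The circular element. -/
def circElem (e : Bool) : C.fockVN.Elem := ⟨C.circOp e, mem_generated_of_mem (C.circOp_mem e)⟩

theorem star_circElem (e) : star (C.circElem e) = C.circElem (!e) := Subtype.ext (C.star_circOp e)

/-- Chebyshev polynomials in the circular element. -/
def cheb : ℕ → C.fockVN.Elem
  | 0 => 1
  | 1 => C.circElem true
  | n + 2 => C.circElem (altLetter (n + 1)) * cheb (n + 1) - cheb n

theorem cheb_apply_Ω (n : ℕ) : (C.cheb n : C.Fock →L[ℂ] C.Fock) C.Ω = C.toFock (C.altVec n) := by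
  induction n using Nat.twoStepInduction with
  | zero => rfl
  | one =>
    have : (C.cheb 1 : C.Fock →L[ℂ] C.Fock) C.Ω = C.circOp true (C.toFock (C.altVec 0)) := rfl
    rw [this, circOp_apply, circ_altVec_zero]
  | more n h1 h2 =>
    have : (C.cheb (n + 2) : C.Fock →L[ℂ] C.Fock) C.Ω =
      C.circOp (altLetter (n + 1)) ((C.cheb (n + 1) : C.Fock →L[ℂ] C.Fock) C.Ω) -
        (C.cheb n : C.Fock →L[ℂ] C.Fock) C.Ω := rfl
    rw [this, h1, h2, circOp_apply, circ_altVec_succ, toFock, toFock,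
      ← UniformSpace.Completion.coe_sub, add_sub_cancel_right]

/-- Even Chebyshev polynomials have constant term `±1`, and their other terms begin with `y* y`; odd
ones begin with `y`. -/
theorem exists_cheb_eq (k : ℕ) :
    (∃ r, C.cheb (2 * k) = (-1) ^ k + star (C.circElem true) * C.circElem true * r) ∧
      ∃ s, C.cheb (2 * k + 1) = C.circElem true * s := by
  induction k with
  | zero => exact ⟨⟨0, by simp [cheb]⟩, ⟨1, by simp [cheb]⟩⟩
  | succ k ih =>
    obtain ⟨⟨r, hr⟩, s, hs⟩ := ih
    have h1 : altLetter (2 * k + 1) = false := by simp [altLetter]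
    have h2 : altLetter (2 * k + 2) = true := by
      simp [altLetter, Nat.even_add]
    have e1 : C.cheb (2 * (k + 1))
        = (-1) ^ (k + 1) + star (C.circElem true) * C.circElem true * (s - r) := by
      have : C.cheb (2 * (k + 1)) = C.circElem (altLetter (2 * k + 1)) * C.cheb (2 * k + 1)
        - C.cheb (2 * k) := rfl
      rw [this, h1, hs, hr, star_circElem, Bool.not_true, mul_sub, pow_succ, mul_neg_one,
        ← mul_assoc]
      abel
    refine ⟨⟨_, e1⟩, C.cheb (2 * (k + 1)) - s, ?_⟩
    have : C.cheb (2 * (k + 1) + 1) = C.circElem (altLetter (2 * k + 2)) * C.cheb (2 * (k + 1))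
      - C.cheb (2 * k + 1) := rfl
    rw [this, h2, hs, mul_sub]

/-- The mean of `(-1)^k cheb (2 k)` over `k < n` has the form `1 + y* y r`. It sends the vacuum to a
mean of `n` orthonormal vectors up to signs, so its `‖·‖₂` is `n^(-1/2)`. -/
theorem exists_norm2_one_add_le {ε : ℝ} (hε : 0 < ε) : ∃ r : C.fockVN.Elem,
    C.fockTrace.norm2 (1 + star (C.circElem true) * C.circElem true * r) ≤ ε := by
  obtain ⟨n, hn⟩ := exists_nat_gt (1 / ε ^ 2)
  have hn0 : (0 : ℝ) < n := lt_trans (by positivity) hn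
  have hnC : (n : ℂ) ≠ 0 := by
    have : (n : ℝ) ≠ 0 := hn0.ne'
    exact_mod_cast this
  choose r hr using fun k => (C.exists_cheb_eq k).1
  refine ⟨(n : ℂ)⁻¹ • ∑ k ∈ Finset.range n, ((-1) ^ k : ℂ) • r k, ?_⟩
  have e : 1 + star (C.circElem true) * C.circElem true *
      ((n : ℂ)⁻¹ • ∑ k ∈ Finset.range n, ((-1) ^ k : ℂ) • r k)
      = (n : ℂ)⁻¹ • ∑ k ∈ Finset.range n, ((-1) ^ k : ℂ) • C.cheb (2 * k) := by
    have h1 : ∀ k, ((-1) ^ k : ℂ) • C.cheb (2 * k) = 1 +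
        star (C.circElem true) * C.circElem true * (((-1) ^ k : ℂ) • r k) := fun k => by
      have h2 : ((-1) ^ k : ℂ) • ((-1) ^ k : C.fockVN.Elem) = 1 := by
        rcases Nat.even_or_odd k with h | h <;> simp [h.neg_one_pow]
      rw [hr, smul_add, h2, mul_smul_comm]
    simp only [h1, Finset.sum_add_distrib, Finset.sum_const, Finset.card_range, ← Finset.mul_sum]
    rw [smul_add, ← mul_smul_comm, ← Nat.cast_smul_eq_nsmul ℂ, smul_smul, inv_mul_cancel₀ hnC,
      one_smul]
  rw [e, fockTrace, C.isTracialVector_Ω.norm2_trace]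
  set q : C.PreFock := (n : ℂ)⁻¹ • ∑ k ∈ Finset.range n, ((-1) ^ k : ℂ) • C.altVec (2 * k) with hq
  have hqΩ : (((n : ℂ)⁻¹ • ∑ k ∈ Finset.range n, ((-1) ^ k : ℂ) • C.cheb (2 * k) :
      C.fockVN.Elem) : C.Fock →L[ℂ] C.Fock) C.Ω = C.toFock q := by
    have h1 : ∀ s : Finset ℕ, ((∑ k ∈ s, ((-1) ^ k : ℂ) • C.cheb (2 * k) :
        C.fockVN.Elem) : C.Fock →L[ℂ] C.Fock) C.Ω
        = C.toFock (∑ k ∈ s, ((-1) ^ k : ℂ) • C.altVec (2 * k)) := by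
      intro s
      induction s using Finset.induction_on with
      | empty => simp
      | insert a s ha ih =>
        rw [Finset.sum_insert ha, Finset.sum_insert ha, toFock, UniformSpace.Completion.coe_add,
          UniformSpace.Completion.coe_smul]
        refine Eq.trans ?_ (congrArg₂ (· + ·) (congrArg (((-1) ^ a : ℂ) • ·)
          (C.cheb_apply_Ω (2 * a))) ih)
        rfl
    rw [hq, toFock, UniformSpace.Completion.coe_smul]
    exact congrArg ((n : ℂ)⁻¹ • ·) (h1 _)
  have hnorm : ‖q‖ ^ 2 = (n : ℝ)⁻¹ := by
    have h1 : ∀ k, ((-1 : ℂ) ^ k) * (-1) ^ k = 1 := fun k => by rw [← mul_pow]; simp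
    have hS : inner ℂ (∑ k ∈ Finset.range n, ((-1) ^ k : ℂ) • C.altVec (2 * k))
        (∑ k ∈ Finset.range n, ((-1) ^ k : ℂ) • C.altVec (2 * k)) = (n : ℂ) := by
      simp only [inner_smul_left, inner_smul_right, sum_inner, inner_sum, inner_altVec]
      have h2 : ∀ x ∈ Finset.range n, (-1 : ℂ) ^ x * ∑ i ∈ Finset.range n,
          (starRingEnd ℂ) ((-1) ^ i) * (if 2 * i = 2 * x then (1 : ℂ) else 0) = 1 := by
        intro x hx
        rw [Finset.sum_eq_single x]
        · simp [h1]
        · intro i _ hi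
          rw [if_neg (by omega), mul_zero]
        · exact fun h => absurd hx h
      rw [Finset.sum_congr rfl h2]
      simp
    have hS' : ‖∑ k ∈ Finset.range n, ((-1) ^ k : ℂ) • C.altVec (2 * k)‖ ^ 2 = (n : ℝ) := by
      rw [← inner_self_eq_norm_sq (𝕜 := ℂ), hS]
      simp
    rw [hq, norm_smul, mul_pow, hS', norm_inv, Complex.norm_natCast]
    field_simp
  rw [hqΩ, UniformSpace.Completion.norm_coe]
  refine le_of_sq_le_sq ?_ hε.le
  rw [hnorm, inv_le_comm₀ hn0 (by positivity), ← one_div]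
  exact hn.le

/-- Elements conjugate under the circular element are approximately unitarily conjugate. -/
theorem exists_almost_unitary_intertwiner {ε : ℝ} (hε : 0 < ε) : ∃ v : C.fockVN.Elem,
    C.fockTrace.norm2 (star v * v - 1) ≤ ε ∧ ∀ x x' : M.Elem,
      (∀ b, C.η true (x * b) = x' * C.η true b) →
      (∀ b, C.η true (star x * b) = star x' * C.η true b) →
      (∀ b, C.η false (x' * b) = x * C.η false b) →
      (∀ b, C.η false (star x' * b) = star x * C.η false b) →
        C.embed x * v = v * C.embed x' := by
  obtain ⟨c, hc, hcomm⟩ := C.fockTrace.exists_almost_unitary_mul (C.circElem true)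
    (fun ε hε => C.exists_norm2_one_add_le hε) hε
  refine ⟨C.circElem true * c, hc, fun x x' h1 h2 h3 h4 => ?_⟩
  have e1 : C.embed x * C.circElem true = C.circElem true * C.embed x' :=
    Subtype.ext (C.rep_mul_circOp h2 h3)
  have e2 : C.embed (star x) * C.circElem true = C.circElem true * C.embed (star x') :=
    Subtype.ext (C.rep_mul_circOp (by simpa using h1) h4)
  have e3 := congrArg star e2
  rw [star_mul, star_mul, StarHomClass.map_star C.embed, StarHomClass.map_star C.embed, star_star,
    star_star] at e3
  -- As `y` and `y*` intertwine in opposite directions, `y* y` commutes with the image of `x'`, and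
  -- so does its function `c`.
  have e4 : Commute (star (C.circElem true) * C.circElem true) (C.embed x') := by
    rw [Commute, SemiconjBy, mul_assoc, ← e1, ← mul_assoc, e3, mul_assoc]
  rw [← mul_assoc, e1, mul_assoc, mul_assoc, (hcomm _ e4).eq]

end Covariance

end Trace

end VonNeumannAlgebra

end

/-! ### Descent to an existentially closed algebra -/

noncomputable section

namespace VonNeumannAlgebra

namespace Trace

variable {H : Type u} [NormedAddCommGroup H] [InnerProductSpace ℂ H] [CompleteSpace H]
  {M : VonNeumannAlgebra H} {τ : Trace M}
  {K : Type u} [NormedAddCommGroup K] [InnerProductSpace ℂ K] [CompleteSpace K]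
  {N : VonNeumannAlgebra K} {σ : Trace N} {f g : N.Elem →⋆ₐ[ℂ] M.Elem}

theorem Preserves.exists_map_adj_gram (hf : σ.Preserves τ f) (g : N.Elem →⋆ₐ[ℂ] M.Elem)
    {ι : Type*} [Fintype ι] (b : ι → M.Elem) : ∃ d : ι → ι → M.Elem,
      ∀ i j, g (hf.adj (star (b i) * b j)) = ∑ k, star (d k i) * d k j := by
  obtain ⟨d, hd⟩ := hf.exists_adj_gram b
  refine ⟨fun k i => g (d k i), fun i j => ?_⟩
  rw [hd, map_sum]
  simp only [map_mul g, StarHomClass.map_star g]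

/-- Supplies the duality of the covariance: `g ∘ E_f` has the adjoint `f ∘ E_g`. -/
theorem Preserves.apply_map_adj_mul (hf : σ.Preserves τ f) (hg : σ.Preserves τ g) (a b : M.Elem) :
    τ (g (hf.adj a) * b) = τ (a * f (hg.adj b)) := by
  rw [τ.mul_comm, ← hg.apply_adj_mul, σ.mul_comm, hf.apply_adj_mul]

/-- The covariance of a circular element that intertwines two embeddings of `N` into `M`. -/
def Preserves.covariance (hf : σ.Preserves τ f) (hg : σ.Preserves τ g) : Covariance τ where
  η e := bif e then g.toLinearMap ∘ₗ hf.adj else f.toLinearMap ∘ₗ hg.adj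
  map_star e a := by
    cases e
    · exact (congrArg f (hg.adj_star a)).trans (StarHomClass.map_star f _)
    · exact (congrArg g (hf.adj_star a)).trans (StarHomClass.map_star g _)
  map_one e := by
    cases e
    · exact (congrArg f hg.adj_one).trans (_root_.map_one f)
    · exact (congrArg g hf.adj_one).trans (_root_.map_one g)
  dual e a b := by
    cases e
    · exact hg.apply_map_adj_mul hf a b
    · exact hf.apply_map_adj_mul hg a b
  gram e _ _ b := by
    cases e
    · exact hg.exists_map_adj_gram f b
    · exact hf.exists_map_adj_gram g b

theorem Preserves.covariance_true_mul (hf : σ.Preserves τ f) (hg : σ.Preserves τ g) (x : N.Elem)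
    (b : M.Elem) :
    (hf.covariance hg).η true (f x * b) = g x * (hf.covariance hg).η true b :=
  (congrArg g (hf.adj_mul_left b x)).trans (map_mul g _ _)

theorem Preserves.covariance_false_mul (hf : σ.Preserves τ f) (hg : σ.Preserves τ g) (x : N.Elem)
    (b : M.Elem) :
    (hf.covariance hg).η false (g x * b) = f x * (hf.covariance hg).η false b :=
  (congrArg f (hg.adj_mul_left b x)).trans (map_mul f _ _)

/-- Any two embeddings into `M` become almost unitarily conjugate in an extension of `M`. -/
theorem Preserves.exists_almost_unitary_intertwiner (hf : σ.Preserves τ f) (hg : σ.Preserves τ g)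
    {ε : ℝ} (hε : 0 < ε) : ∃ v : (hf.covariance hg).fockVN.Elem,
      (hf.covariance hg).fockTrace.norm2 (star v * v - 1) ≤ ε ∧
      ∀ x, (hf.covariance hg).embed (f x) * v = v * (hf.covariance hg).embed (g x) := by
  obtain ⟨v, hv, h⟩ := (hf.covariance hg).exists_almost_unitary_intertwiner hε
  refine ⟨v, hv, fun x => h _ _ (hf.covariance_true_mul hg x) ?_ (hf.covariance_false_mul hg x) ?_⟩
  · rw [← StarHomClass.map_star f, ← StarHomClass.map_star g]
    exact hf.covariance_true_mul hg _
  · rw [← StarHomClass.map_star f, ← StarHomClass.map_star g]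
    exact hf.covariance_false_mul hg _

theorem tendsto_norm2_sq {I : Type u} (U : Ultrafilter I) (x : boundedFamilies M I) :
    Tendsto (fun i => τ.norm2 (x.1 i) ^ 2) U
      (𝓝 (τ.ultraTrace U (star (τ.mkU U x) * τ.mkU U x)).re) := by
  simp only [norm2_sq]
  exact (Complex.continuous_re.tendsto _).comp (τ.tendsto_ultraTrace U (star x * x))

theorem norm2_unitary_conj_sub_le {u : M.Elem} (hu : u ∈ unitary M.Elem) (v x y : M.Elem) :
    τ.norm2 (u * y * star u - x) ≤
      τ.norm2 (x * v - v * y) + (‖x‖ + ‖y‖) * τ.norm2 (u - v) := by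
  have e : (u * y * star u - x) * u = ((u - v) * y - x * (u - v)) - (x * v - v * y) := by
    rw [sub_mul, mul_assoc, (Unitary.mem_iff.1 hu).1]
    noncomm_ring
  rw [← τ.norm2_mul_unitary hu, e]
  refine (τ.norm2_sub _ _).trans ?_
  have h1 := τ.norm2_sub ((u - v) * y) (x * (u - v))
  have h2 := τ.norm2_mul_le' (u - v) y
  have h3 := τ.norm2_mul_le x (u - v)
  linarith

theorem tendsto_norm2_star_mul_self_sub_one {I : Type u} {U : Ultrafilter I}
    (G : N.Elem →⋆ₐ[ℂ] τ.Ultrapower U) (hG : ∀ y, τ.ultraTrace U (G y) = σ y) {v : N.Elem}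
    {w : boundedFamilies M I} (hw : τ.mkU U w = G v) :
    Tendsto (fun i => τ.norm2 (star (w.1 i) * w.1 i - 1) ^ 2) U
      (𝓝 (σ.norm2 (star v * v - 1) ^ 2)) := by
  have ht := τ.tendsto_norm2_sq U (star w * w - 1)
  have e : τ.mkU U (star w * w - 1) = G (star v * v - 1) := by
    rw [map_sub G, map_mul G, StarHomClass.map_star G, _root_.map_one G, ← hw]
    rfl
  rwa [e, ← StarHomClass.map_star G, ← map_mul G, hG, ← norm2_sq] at ht

theorem tendsto_norm2_mul_sub_mul {I : Type u} {U : Ultrafilter I} {w : boundedFamilies M I}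
    {a b : M.Elem} (h : τ.diagonal U a * τ.mkU U w = τ.mkU U w * τ.diagonal U b) :
    Tendsto (fun i => τ.norm2 (a * w.1 i - w.1 i * b)) U (𝓝 0) := by
  let da : boundedFamilies M I := ⟨fun _ => a, ‖a‖, fun _ => le_rfl⟩
  let db : boundedFamilies M I := ⟨fun _ => b, ‖b‖, fun _ => le_rfl⟩
  have e : τ.mkU U (da * w) = τ.mkU U (w * db) := h
  exact Ideal.Quotient.eq.1 e

/-- In an existentially closed algebra any two embeddings are intertwined, approximately, by an
almost unitary element. -/
theorem IsExistentiallyClosed.exists_almost_unitary (hec : τ.IsExistentiallyClosed)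
    (hf : σ.Preserves τ f) (hg : σ.Preserves τ g) (F : Finset N.Elem) {ε δ : ℝ} (hε : 0 < ε)
    (hδ : 0 < δ) : ∃ w : M.Elem, τ.norm2 (star w * w - 1) ≤ δ ∧
      ∀ x ∈ F, τ.norm2 (f x * w - w * g x) < ε := by
  -- The bound `δ / 2` leaves the strict inequality needed to pass from the ultralimit to almost
  -- every index.
  obtain ⟨v, hv, hvx⟩ := hf.exists_almost_unitary_intertwiner hg (half_pos hδ)
  obtain ⟨I, U, G, hG, hGd⟩ := hec _ _ _ _ (hf.covariance hg).preserves_embed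
  obtain ⟨w, hw⟩ : ∃ w, τ.mkU U w = G v := Ideal.Quotient.mk_surjective (G v)
  have h1 : ∀ᶠ i in (U : Filter I), τ.norm2 (star (w.1 i) * w.1 i - 1) ≤ δ := by
    have hlt : (hf.covariance hg).fockTrace.norm2 (star v * v - 1) ^ 2 < δ ^ 2 :=
      pow_lt_pow_left₀ (hv.trans_lt (half_lt_self hδ)) (norm2_nonneg _ _) two_ne_zero
    filter_upwards [(tendsto_norm2_star_mul_self_sub_one G hG hw).eventually_lt_const hlt] with i hi
    exact (lt_of_pow_lt_pow_left₀ 2 hδ.le hi).le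
  have h2 : ∀ᶠ i in (U : Filter I), ∀ x ∈ F, τ.norm2 (f x * w.1 i - w.1 i * g x) < ε := by
    rw [Filter.eventually_all_finset]
    intro x _
    refine (tendsto_norm2_mul_sub_mul ?_).eventually_lt_const hε
    rw [← hGd, ← hGd, hw, ← map_mul G, ← map_mul G, hvx]
  obtain ⟨i, hi1, hi2⟩ := (h1.and h2).exists
  exact ⟨w.1 i, hi1, hi2⟩

/-- Any two embeddings of a tracial von Neumann algebra into an existentially closed one are
approximately unitarily conjugate. -/
theorem IsExistentiallyClosed.approxUnitarilyConjugate (hec : τ.IsExistentiallyClosed)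
    (hf : σ.Preserves τ f) (hg : σ.Preserves τ g) : τ.ApproxUnitarilyConjugate g f := by
  intro F ε hε
  obtain ⟨B, hB, hFB⟩ : ∃ B : ℝ, 0 < B ∧ ∀ x ∈ F, ‖f x‖ + ‖g x‖ ≤ B :=
    ⟨1 + ∑ x ∈ F, (‖f x‖ + ‖g x‖), by positivity, fun x hx =>
      (Finset.single_le_sum (f := fun x => ‖f x‖ + ‖g x‖) (fun _ _ => by positivity) hx).trans
        (le_add_of_nonneg_left zero_le_one)⟩
  -- A defect of `δ²` puts a unitary within `5 δ`, which costs at most `5 B δ ≤ ε / 2` in the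
  -- commutation estimate; the other half of `ε` bounds `‖f(x) w - w g(x)‖₂`.
  obtain ⟨δ, hδ, hδ1, hδB⟩ : ∃ δ : ℝ, 0 < δ ∧ δ ≤ 1 ∧ B * (5 * δ) ≤ ε / 2 := by
    refine ⟨min 1 (ε / (10 * B)), by positivity, min_le_left _ _, ?_⟩
    have h1 : B * (5 * min 1 (ε / (10 * B))) ≤ B * (5 * (ε / (10 * B))) := by
      gcongr
      exact min_le_right _ _
    refine h1.trans (le_of_eq ?_)
    field_simp
    norm_num
  obtain ⟨w, hw1, hw2⟩ := hec.exists_almost_unitary hf hg F (half_pos hε) (pow_pos hδ 2)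
  obtain ⟨u, hu, huv⟩ := τ.exists_unitary_near w hδ hw1 hδ1
  refine ⟨u, hu, fun x hx => ?_⟩
  have h3 : (‖f x‖ + ‖g x‖) * τ.norm2 (u - w) ≤ B * (5 * δ) :=
    mul_le_mul (hFB x hx) huv (τ.norm2_nonneg _) hB.le
  have h4 := norm2_unitary_conj_sub_le (τ := τ) hu w (f x) (g x)
  have h5 := hw2 x hx
  linarith

/-- The unitary `v n` serves the first `n + 1` points of a dense sequence to within `1 / (n + 1)`.
Conjugation by `v n` and `f` both preserve `‖·‖₂`, so convergence on the sequence spreads to all of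
`M`. -/
theorem ApproxUnitarilyConjugate.isApproximatelyInner {f : M.Elem →⋆ₐ[ℂ] M.Elem}
    (hf : τ.Preserves τ f) (h : τ.ApproxUnitarilyConjugate (fun x => x) f) (hs : τ.IsSeparable) :
    τ.IsApproximatelyInner f := by
  obtain ⟨S, hS, hd⟩ := hs
  have hne : S.Nonempty := by
    obtain ⟨s, hs, -⟩ := hd 0 1 one_pos
    exact ⟨s, hs⟩
  obtain ⟨s, rfl⟩ := hS.exists_eq_range hne
  classical
  choose v hv hvs using fun n : ℕ =>
    h ((Finset.range (n + 1)).image s) (1 / (n + 1 : ℝ)) Nat.one_div_pos_of_nat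
  refine ⟨v, hv, fun x => ?_⟩
  rw [Metric.tendsto_atTop]
  intro ε hε
  obtain ⟨_, ⟨m, rfl⟩, hm⟩ := hd x (ε / 3) (by positivity)
  obtain ⟨k, hk⟩ := exists_nat_one_div_lt (show (0 : ℝ) < ε / 3 by positivity)
  refine ⟨max m k, fun n hn => ?_⟩
  rw [Real.dist_0_eq_abs, abs_of_nonneg (τ.norm2_nonneg _)]
  have hmn : m ≤ n := (le_max_left _ _).trans hn
  have hkn : (k : ℝ) ≤ n := by exact_mod_cast (le_max_right _ _).trans hn
  have h1 : τ.norm2 (v n * s m * star (v n) - f (s m)) < ε / 3 :=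
    (hvs n (s m) (Finset.mem_image_of_mem s (Finset.mem_range.2 (by omega)))).trans
      ((one_div_le_one_div_of_le (by positivity) (by linarith)).trans_lt hk)
  have h2 : τ.norm2 (v n * (x - s m) * star (v n)) < ε / 3 := by
    rwa [τ.norm2_mul_unitary (Unitary.star_mem (hv n)), τ.norm2_unitary_mul (hv n)]
  have h3 : τ.norm2 (f (x - s m)) < ε / 3 := by rwa [hf.norm2_map]
  have e : v n * x * star (v n) - f x = v n * (x - s m) * star (v n) +
      (v n * s m * star (v n) - f (s m)) - f (x - s m) := by
    rw [map_sub f]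
    noncomm_ring
  rw [e]
  have h4 := τ.norm2_sub (v n * (x - s m) * star (v n) +
      (v n * s m * star (v n) - f (s m))) (f (x - s m))
  have h5 := τ.norm2_add (v n * (x - s m) * star (v n)) (v n * s m * star (v n) - f (s m))
  linarith

end Trace

end VonNeumannAlgebra

end

theorem theorem4 {H : Type u} [NormedAddCommGroup H] [InnerProductSpace ℂ H] [CompleteSpace H]
    (M : VonNeumannAlgebra H) (τ : M.Trace) (hM : τ.IsIIOneFactor)
    (hec : τ.IsExistentiallyClosed) :
    (∀ (N : VonNeumannAlgebra H) (hN : N ≤ M) (f : N.Elem →⋆ₐ[ℂ] M.Elem),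
      (τ.restrict hN).Preserves τ f →
        τ.ApproxUnitarilyConjugate f (fun x : N.Elem => (⟨x.1, hN x.2⟩ : M.Elem))) ∧
    (τ.IsSeparable → ∀ f : M.Elem →⋆ₐ[ℂ] M.Elem, τ.Preserves τ f →
      τ.IsApproximatelyInner f) := by
  refine ⟨fun N hN f hf => ?_, fun hs f hf => ?_⟩
  · have hι : (τ.restrict hN).Preserves τ
        (StarSubalgebra.inclusion (show N.toStarSubalgebra ≤ M.toStarSubalgebra from hN)) :=
      fun _ => rfl
    intro F ε hε
    exact hec.approxUnitarilyConjugate hι hf F ε hε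
  · have hid : τ.Preserves τ (StarAlgHom.id ℂ M.Elem) := fun _ => rfl
    -- The roles are exchanged compared with the first part: here the identity is conjugated towards
    -- `f`.
    exact (hec.approxUnitarilyConjugate hf hid).isApproximatelyInner hf hs
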